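/- Let $M$ be a smooth manifold of dimension $m+1$ and let $\mathscr{L}\colon TM\setminus 0\to\mathbb{R}$ be a smooth function, positively homogeneous of degree two on the fibres ($\mathscr{L}(x,sv)=s^2\mathscr{L}(x,v)$ for $s>0$), such that the fibre Hessian $g_v=(g_{\mu\nu}(x,v))$, $g_{\mu\nu}=\partial^2\mathscr{L}/\partial v^\mu\partial v^\nu$, has signature $(-,+,\dots,+)$ at every $v\neq 0$. Fix a connected component of $\{\mathscr{L}<0\}$, the future timelike cone; a vector $v\ne0$ with $\mathscr{L}(v)=0$ on the boundary of this cone is called future-directed lightlike. In local coordinates let $$2G^\alpha=g^{\alpha\delta}\Big(\frac{\partial^2\mathscr{L}}{\partial x^\gamma\partial v^\delta}v^\gamma-\frac{\partial\mathscr{L}}{\partial x^\delta}\Big),\qquad N^\mu_\alpha=\frac{\partial G^\mu}{\partial v^\alpha},\qquad \frac{\delta}{\delta x^\alpha}=\frac{\partial}{\partial x^\alpha}-N^\nu_\alpha\frac{\partial}{\partial v^\nu}.$$ The non-linear curvature at the support vector $v$ is $R^N_v(X,Y)^\mu=R^\mu{}_{\alpha\beta}(x,v)X^\alpha Y^\beta$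 with $R^\mu{}_{\alpha\beta}=\frac{\delta N^\mu_\beta}{\delta x^\alpha}-\frac{\delta N^\mu_\alpha}{\delta x^\beta}$, the Ricci 1-form is $Ric_v(Y)=\operatorname{Tr}(X\mapsto R^N_v(X,Y))$, and the covariant derivative of a nowhere vanishing field $s$ is $(D_Xs)^\alpha=X(s^\alpha)+N^\alpha_\mu(x,s)X^\mu$. Let $H$ be an (immersed) $C^2$ null hypersurface of $M$: at every $p\in H$ there is a future-directed lightlike $n\in T_pH$ with $\ker g_n(n,\cdot)=T_pH$. Let $n$ be a field of such vectors on $H$, of class $C^2$ as a map $H\to TM$. Suppose that $H$ is totally geodesic, that is, there is a 1-form $\omega$ on $H$ with $D_Xn=\omega(X)\,n$ for every $X\in TH$. Then $\omega$ is of class $C^1$, and for all $X,Y\in T_pH$, $p\in H$, $$R^N_n(X,Y)=\mathrm{d}\omega(X,Y)\,n,\qquad Ric_n(Y)=\mathrm{d}\omega(n,Y),$$ where $\mathrm{d}\omega(X,Y)=X(\omega(Y))-Y(\omega(X))-\omega([X,Y])$ for vector fields $X,Y$ tangent to $H$. -/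

import Mathlib

open scoped Manifold ContDiff

noncomputable section

namespace LorentzFinsler

/-! ### Finsler calculus in a chart

`Λ (x, v)` is the coordinate expression of a Lagrangian, `x` being the position and `v` the velocity;
all positions and velocities lie in the model space `E`. Each of the following definitions is the
index-free form of a coordinate formula. -/

section Local

variable {E : Type*} [NormedAddCommGroup E] [NormedSpace ℝ E]

/-- The fibre derivative `∂Λ/∂v^δ` at `(x, v)`, as a covector. -/
def fibreDeriv (Λ : E × E → ℝ) (z : E × E) : E →L[ℝ] ℝ :=
  fderiv ℝ (fun w => Λ (z.1, w)) z.2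

/-- The Finsler metric `g_{μν} = ∂²Λ/∂v^μ∂v^ν` at `(x, v)`: the bilinear form
`ξ, η ↦ g_{μν} ξ^μ η^ν`. -/
def localMetric (Λ : E × E → ℝ) (z : E × E) : E →L[ℝ] E →L[ℝ] ℝ :=
  fderiv ℝ (fun w => fibreDeriv Λ (z.1, w)) z.2

/-- The covector `∂²Λ/∂x^γ∂v^δ v^γ - ∂Λ/∂x^δ` at `(x, v)`. -/
def lagrangeCovector (Λ : E × E → ℝ) (z : E × E) : E →L[ℝ] ℝ :=
  fderiv ℝ (fun y => fibreDeriv Λ (y, z.2)) z.1 z.2 - fderiv ℝ (fun y => Λ (y, z.2)) z.1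

/-- The spray coefficients `G^α`, where
`2 G^α = g^{αδ} (∂²Λ/∂x^γ∂v^δ v^γ - ∂Λ/∂x^δ)`. -/
def spray (Λ : E × E → ℝ) (z : E × E) : E :=
  (1 / 2 : ℝ) • (localMetric Λ z).inverse (lagrangeCovector Λ z)

/-- The coefficients `N^μ_α = ∂G^μ/∂v^α` of the non-linear connection: the map
`ξ ↦ N^μ_α ξ^α`. -/
def nonlinConn (Λ : E × E → ℝ) (z : E × E) : E →L[ℝ] E :=
  fderiv ℝ (fun w => spray Λ (z.1, w)) z.2

/-- The horizontal derivative of the connection coefficients: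
`ξ, η ↦ (δN^μ_β/δx^α) ξ^α η^β`, where `δ/δx^α = ∂/∂x^α - N^ν_α ∂/∂v^ν`. -/
def horDerivConn (Λ : E × E → ℝ) (z : E × E) : E →L[ℝ] E →L[ℝ] E :=
  (fderiv ℝ (nonlinConn Λ) z).comp ((ContinuousLinearMap.id ℝ E).prod (-(nonlinConn Λ z)))

/-- The curvature of the non-linear connection,
`R^μ_{αβ} = δN^μ_β/δx^α - δN^μ_α/δx^β`, as the bilinear map `ξ, η ↦ R^μ_{αβ} ξ^α η^β`. -/
def localCurvature (Λ : E × E → ℝ) (z : E × E) : E →L[ℝ] E →L[ℝ] E :=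
  horDerivConn Λ z - (horDerivConn Λ z).flip

/-- The Ricci covector `Ric_α = R^μ_{μα}`: the trace of `ξ ↦ R(ξ, η)` as a function of `η`. -/
def localRicci (Λ : E × E → ℝ) (z : E × E) (η : E) : ℝ :=
  LinearMap.trace ℝ E ((localCurvature Λ z).flip η : E →L[ℝ] E)

/-- A symmetric bilinear form of signature `(-, +, …, +)`. -/
def IsLorentzian (B : E →L[ℝ] E →L[ℝ] ℝ) : Prop :=
  (∀ u w, B u w = B w u) ∧
    ∃ t, B t t < 0 ∧ ∀ w, B t w = 0 → w ≠ 0 → 0 < B w w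

end Local

/-! ### Finsler spacetimes -/

section Global

variable {E : Type*} [NormedAddCommGroup E] [NormedSpace ℝ E]
  {M : Type*} [TopologicalSpace M] [ChartedSpace E M] [IsManifold 𝓘(ℝ, E) ∞ M]

/-- The expression of a function on the tangent bundle in the chart of the tangent bundle that is
induced by the preferred chart of `M` at `p`. -/
def inChart (L : TangentBundle 𝓘(ℝ, E) M → ℝ) (p : M) : E × E → ℝ :=
  fun z => L ((extChartAt 𝓘(ℝ, E).tangent (⟨p, 0⟩ : TangentBundle 𝓘(ℝ, E) M)).symm z)

/-- The coordinates of the tangent vector `v` at `p` in the induced chart at `p`. In Mathlib the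
tangent space at `p` is the model space, a vector being given by its components in the preferred
chart at `p`. -/
def coords (p : M) (v : TangentSpace 𝓘(ℝ, E) p) : E × E := (extChartAt 𝓘(ℝ, E) p p, v)

/-- The metric `g_v` at `p` of a Lagrangian `L`. -/
def metricOf (L : TangentBundle 𝓘(ℝ, E) M → ℝ) (p : M) (v : TangentSpace 𝓘(ℝ, E) p) :
    TangentSpace 𝓘(ℝ, E) p →L[ℝ] TangentSpace 𝓘(ℝ, E) p →L[ℝ] ℝ :=
  localMetric (E := E) (inChart L p) (coords p v)

variable (E M) in
/-- A Finsler spacetime: a smooth Lagrangian on the slit tangent bundle (its values on the zero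
section are irrelevant), positively homogeneous of degree two, with Lorentzian fibre Hessian,
together with a connected component of the locus where the Lagrangian is negative, the future
timelike cone. -/
structure FinslerSpacetime where
  /-- The Finsler Lagrangian. -/
  L : TangentBundle 𝓘(ℝ, E) M → ℝ
  smooth : ContMDiffOn 𝓘(ℝ, E).tangent 𝓘(ℝ, ℝ) ∞ L {z | z.2 ≠ 0}
  homogeneous : ∀ (p : M) (v : TangentSpace 𝓘(ℝ, E) p), v ≠ 0 → ∀ s : ℝ, 0 < s →
    L ⟨p, s • v⟩ = s ^ 2 * L ⟨p, v⟩
  lorentzian : ∀ (p : M) (v : TangentSpace 𝓘(ℝ, E) p), v ≠ 0 →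
    IsLorentzian (E := E) (metricOf L p v)
  /-- The future timelike cone. -/
  futureCone : Set (TangentBundle 𝓘(ℝ, E) M)
  isComponent : ∃ z, z.2 ≠ 0 ∧ L z < 0 ∧ futureCone = connectedComponentIn {z | z.2 ≠ 0 ∧ L z < 0} z

namespace FinslerSpacetime

variable (S : FinslerSpacetime E M)

/-- The metric `g_v`. -/
def metric (p : M) (v : TangentSpace 𝓘(ℝ, E) p) :
    TangentSpace 𝓘(ℝ, E) p →L[ℝ] TangentSpace 𝓘(ℝ, E) p →L[ℝ] ℝ :=
  metricOf S.L p v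

/-- Future-directed lightlike vectors: the non-zero vectors on the boundary of the future timelike
cone, on which the Lagrangian vanishes. -/
def IsFutureLightlike (p : M) (v : TangentSpace 𝓘(ℝ, E) p) : Prop :=
  v ≠ 0 ∧ S.L ⟨p, v⟩ = 0 ∧ (⟨p, v⟩ : TangentBundle 𝓘(ℝ, E) M) ∈ frontier S.futureCone

/-- The non-linear curvature `R^N_v` at support vector `v`. -/
def curvature (p : M) (v : TangentSpace 𝓘(ℝ, E) p) :
    TangentSpace 𝓘(ℝ, E) p →L[ℝ] TangentSpace 𝓘(ℝ, E) p →L[ℝ] TangentSpace 𝓘(ℝ, E) p :=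
  localCurvature (E := E) (inChart S.L p) (coords p v)

/-- The Ricci 1-form `Ric_v(Y) = Tr (X ↦ R^N_v(X, Y))`. -/
def ricciForm (p : M) (v Y : TangentSpace 𝓘(ℝ, E) p) : ℝ :=
  localRicci (E := E) (inChart S.L p) (coords p v) Y

/-! ### Hypersurfaces

A hypersurface is an immersion `ι : H → M`. -/

variable {F : Type*} [NormedAddCommGroup F] [NormedSpace ℝ F]
  {H : Type*} [TopologicalSpace H] [ChartedSpace F H]

/-- The differential of `ι`, which identifies the vectors tangent to `H` with vectors of `M`. -/
abbrev push (ι : H → M) (q : H) :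
    TangentSpace 𝓘(ℝ, F) q →L[ℝ] TangentSpace 𝓘(ℝ, E) (ι q) :=
  mfderiv 𝓘(ℝ, F) 𝓘(ℝ, E) ι q

/-- The covariant derivative `X ↦ D_X s` of the non-linear connection, for a field `s` of vectors of
`M` that is defined along `H` and for `X` tangent to `H`:
`D_X s^α = X(s^α) + N^α_μ(x, s) X^μ` in the chart at the point considered. -/
def covDeriv (ι : H → M) (s : (q : H) → TangentSpace 𝓘(ℝ, E) (ι q)) (q : H) :
    TangentSpace 𝓘(ℝ, F) q →L[ℝ] TangentSpace 𝓘(ℝ, E) (ι q) :=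
  let components : H → E := fun q' =>
    (extChartAt 𝓘(ℝ, E).tangent (⟨ι q, 0⟩ : TangentBundle 𝓘(ℝ, E) M) ⟨ι q', s q'⟩).2
  let dComponents : F →L[ℝ] E := mfderiv 𝓘(ℝ, F) 𝓘(ℝ, E) components q
  let dι : F →L[ℝ] E := push ι q
  dComponents + (nonlinConn (inChart S.L (ι q)) (coords (ι q) (s q))).comp dι

/-- A vector `k` tangent to `H` at `q` is a null generator if it is future-directed lightlike and
`ker g_k(k, ·)` is the tangent space of `H`. -/
def IsNullGenerator (ι : H → M) (q : H) (k : TangentSpace 𝓘(ℝ, F) q) : Prop :=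
  S.IsFutureLightlike (ι q) (push ι q k) ∧
    (S.metric (ι q) (push ι q k) (push ι q k)).ker = (push (E := E) (F := F) ι q).range

/-- `C²` null hypersurfaces. -/
structure IsNullHypersurface (ι : H → M) : Prop where
  contMDiff : ContMDiff 𝓘(ℝ, F) 𝓘(ℝ, E) 2 ι
  immersion : ∀ q, Function.Injective (push (E := E) (F := F) ι q)
  codimension_one : Module.finrank ℝ E = Module.finrank ℝ F + 1
  null : ∀ q, ∃ k : TangentSpace 𝓘(ℝ, F) q, S.IsNullGenerator (F := F) ι q k

/-- The null hypersurface `H` is totally geodesic and `om` is its 1-form relative to the lightlike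
field `n`: `D_X n = om(X) n` for all `X` tangent to `H`. -/
def IsTotallyGeodesicWith (ι : H → M) (n : (q : H) → TangentSpace 𝓘(ℝ, F) q)
    (om : (q : H) → (TangentSpace 𝓘(ℝ, F) q →L[ℝ] ℝ)) : Prop :=
  ∀ (q : H) (X : TangentSpace 𝓘(ℝ, F) q),
    S.covDeriv ι (fun q' => push ι q' (n q')) q X = om q X • push ι q (n q)

end FinslerSpacetime

end Global

/-! ### 1-forms and their exterior derivative -/

section Forms

variable {F : Type*} [NormedAddCommGroup F] [NormedSpace ℝ F]
  {H : Type*} [TopologicalSpace H] [ChartedSpace F H]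

/-- The pullback of a 1-form on `H` by the inverse of the preferred chart at `q`. -/
def formInChart (om : (q : H) → (TangentSpace 𝓘(ℝ, F) q →L[ℝ] ℝ)) (q : H) : F → (F →L[ℝ] ℝ) :=
  fun y => (om ((extChartAt 𝓘(ℝ, F) q).symm y)).comp
    (mfderiv 𝓘(ℝ, F) 𝓘(ℝ, F) (extChartAt 𝓘(ℝ, F) q).symm y)

/-- 1-forms of class `C¹`. -/
def IsC1Form (om : (q : H) → (TangentSpace 𝓘(ℝ, F) q →L[ℝ] ℝ)) : Prop :=
  ∀ q, ContDiffAt ℝ 1 (formInChart om q) (extChartAt 𝓘(ℝ, F) q q)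

/-- The exterior derivative of a 1-form, `dom(X, Y) = X^i Y^j (∂_i om_j - ∂_j om_i)`, computed in the
preferred chart at `q`. -/
def dForm (om : (q : H) → (TangentSpace 𝓘(ℝ, F) q →L[ℝ] ℝ)) (q : H)
    (X Y : TangentSpace 𝓘(ℝ, F) q) : ℝ :=
  let A : F →L[ℝ] F →L[ℝ] ℝ := fderiv ℝ (formInChart om q) (extChartAt 𝓘(ℝ, F) q q)
  A X Y - A Y X

end Forms

end LorentzFinsler

end

open scoped Manifold ContDiff

namespace LorentzFinsler

/-! ### Finsler calculus in one chart: spray, connection, homogeneity, curvature. -/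

section LocalCalculus

variable {E : Type*} [NormedAddCommGroup E] [NormedSpace ℝ E]

/-! In a fixed chart the hypothesis reads `ds + N(x, s) dx = θ ⊗ s`, where `x` is the immersion, `s`
the components of the field and `θ` the form `ω`. Pairing with a functional that does not kill `s`
exhibits `θ` as a quotient of `C¹` maps. Differentiating once more and antisymmetrizing removes the
second derivatives of `s` and `x`. The direction `(dx, ds)` in which `N` is differentiated is the
horizontal lift of `dx` plus `θ` times the vertical vector `(0, s)`; as `N` is homogeneous of degree
one, the vertical part gives back `N`. All terms symmetric in the two directions cancel, and what
remains is `R = dθ ⊗ s` (`localCurvature_eq`). This part holds for a nowhere vanishing `C²` field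
along any `C²` map.

For the Ricci form, `𝓛` is constant along horizontal directions (`fderiv_horizontal`), so the
curvature, a commutator of horizontal fields, is annihilated by the fibre differential of `𝓛`
(`fderiv_curvature`). At `n` that differential is `g_n(n, ·)`, whose kernel is the tangent space of
`H`. Hence `X ↦ R(X, Y)` takes values in this hyperplane and maps the hyperplane into the line of
`n`: a transverse direction adds nothing to the trace, which equals `dω(n, Y)`
(`trace_eq_of_map_hyperplane`).

The global definitions use at each point its own preferred chart, whereas differentiation along `H`
needs one fixed chart. The transformation laws of spray and connection bridge this gap. They follow
from the characterization of `2G` as the unique solution of the Euler-Lagrange equation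
(`eq_spray`), without handling the inverse metric. -/

lemma fibreDeriv_eq {Λ : E × E → ℝ} {z : E × E} (h : DifferentiableAt ℝ Λ z) :
    fibreDeriv Λ z = (fderiv ℝ Λ z).comp (ContinuousLinearMap.inr ℝ E E) := by
  have h1 : HasFDerivAt (fun w : E => (z.1, w)) (ContinuousLinearMap.inr ℝ E E) z.2 :=
    hasFDerivAt_prodMk_right z.1 z.2
  exact (HasFDerivAt.comp (g := Λ) z.2 h.hasFDerivAt h1).fderiv

/-- A Lagrangian in coordinates: smooth on the open conic set `W`, positively homogeneous of
degree two in the velocity, with non-degenerate fibre Hessian. -/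
structure IsFinslerOn (Λ : E × E → ℝ) (W : Set (E × E)) : Prop where
  isOpen : IsOpen W
  contDiffOn : ContDiffOn ℝ ∞ Λ W
  conic : ∀ z ∈ W, ∀ s : ℝ, 0 < s → (z.1, s • z.2) ∈ W
  homogeneous : ∀ z ∈ W, ∀ s : ℝ, 0 < s → Λ (z.1, s • z.2) = s ^ 2 * Λ z
  nondegenerate : ∀ z ∈ W, ∀ u, (∀ w, localMetric Λ z u w = 0) → u = 0

section Smooth

variable {Λ : E × E → ℝ} {W : Set (E × E)} {z : E × E}

lemma contDiffOn_fderiv {V : Type*} [NormedAddCommGroup V] [NormedSpace ℝ V]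
    {Y : Type*} [NormedAddCommGroup Y] [NormedSpace ℝ Y] {f : V → Y} {U : Set V}
    (hU : IsOpen U) (hf : ContDiffOn ℝ ∞ f U) : ContDiffOn ℝ ∞ (fderiv ℝ f) U :=
  hf.fderiv_of_isOpen hU (by simp)

lemma differentiableAt_of_contDiffOn {V : Type*} [NormedAddCommGroup V] [NormedSpace ℝ V]
    {Y : Type*} [NormedAddCommGroup Y] [NormedSpace ℝ Y] {f : V → Y} {U : Set V} {x : V}
    (hU : IsOpen U) (hf : ContDiffOn ℝ ∞ f U) (hx : x ∈ U) : DifferentiableAt ℝ f x :=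
  (hf.contDiffAt (hU.mem_nhds hx)).differentiableAt (by simp)

lemma fderiv_fderiv_symm {V : Type*} [NormedAddCommGroup V] [NormedSpace ℝ V]
    {Y : Type*} [NormedAddCommGroup Y] [NormedSpace ℝ Y] {f : V → Y} {x : V} {n : ℕ∞ω}
    (hf : ContDiffAt ℝ n f x) (hn : 2 ≤ n) (h k : V) :
    fderiv ℝ (fderiv ℝ f) x h k = fderiv ℝ (fderiv ℝ f) x k h :=
  (hf.isSymmSndFDerivAt (by simpa using hn)).eq h k

/-- Partial derivatives become total derivatives of `Λ` on `E × E` evaluated on vertical vectors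
`(0, w)`, so that the chain rule and the symmetry of second derivatives apply. -/
lemma localMetric_apply (hW : IsOpen W) (hΛ : ContDiffOn ℝ ∞ Λ W) (hz : z ∈ W) (u w : E) :
    localMetric Λ z u w = fderiv ℝ (fderiv ℝ Λ) z (0, u) (0, w) := by
  have h1 : HasFDerivAt (fun w : E => (z.1, w)) (ContinuousLinearMap.inr ℝ E E) z.2 :=
    hasFDerivAt_prodMk_right z.1 z.2
  have h2 : (fun w => fibreDeriv Λ (z.1, w)) =ᶠ[nhds z.2]
      fun w => (fderiv ℝ Λ (z.1, w)).comp (ContinuousLinearMap.inr ℝ E E) := by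
    filter_upwards [h1.continuousAt.preimage_mem_nhds (hW.mem_nhds hz)] with w hw
    exact fibreDeriv_eq (differentiableAt_of_contDiffOn hW hΛ hw)
  have h3 : HasFDerivAt (fderiv ℝ Λ) (fderiv ℝ (fderiv ℝ Λ) z) (z.1, z.2) :=
    (differentiableAt_of_contDiffOn hW (contDiffOn_fderiv hW hΛ) hz).hasFDerivAt
  have h4 := ((HasFDerivAt.comp (g := fderiv ℝ Λ) z.2 h3 h1).clm_comp
    (hasFDerivAt_const (ContinuousLinearMap.inr ℝ E E) z.2)).congr_of_eventuallyEq h2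
  rw [localMetric, h4.fderiv]
  simp

lemma lagrangeCovector_apply (hW : IsOpen W) (hΛ : ContDiffOn ℝ ∞ Λ W) (hz : z ∈ W) (w : E) :
    lagrangeCovector Λ z w
      = fderiv ℝ (fderiv ℝ Λ) z (z.2, 0) (0, w) - fderiv ℝ Λ z (w, 0) := by
  have h1 : HasFDerivAt (fun y : E => (y, z.2)) (ContinuousLinearMap.inl ℝ E E) z.1 :=
    hasFDerivAt_prodMk_left z.1 z.2
  have h2 : (fun y => fibreDeriv Λ (y, z.2)) =ᶠ[nhds z.1]
      fun y => (fderiv ℝ Λ (y, z.2)).comp (ContinuousLinearMap.inr ℝ E E) := by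
    filter_upwards [h1.continuousAt.preimage_mem_nhds (hW.mem_nhds hz)] with w hw
    exact fibreDeriv_eq (differentiableAt_of_contDiffOn hW hΛ hw)
  have h3 : HasFDerivAt (fderiv ℝ Λ) (fderiv ℝ (fderiv ℝ Λ) z) (z.1, z.2) :=
    (differentiableAt_of_contDiffOn hW (contDiffOn_fderiv hW hΛ) hz).hasFDerivAt
  have h4 := ((HasFDerivAt.comp (g := fderiv ℝ Λ) z.1 h3 h1).clm_comp
    (hasFDerivAt_const (ContinuousLinearMap.inr ℝ E E) z.1)).congr_of_eventuallyEq h2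
  have h5 : HasFDerivAt Λ (fderiv ℝ Λ z) (z.1, z.2) :=
    (differentiableAt_of_contDiffOn hW hΛ hz).hasFDerivAt
  have h6 : HasFDerivAt (fun y => Λ (y, z.2)) _ z.1 := HasFDerivAt.comp (g := Λ) z.1 h5 h1
  rw [lagrangeCovector, h4.fderiv, h6.fderiv]
  simp

lemma contDiffOn_fibreDeriv (hW : IsOpen W) (hΛ : ContDiffOn ℝ ∞ Λ W) :
    ContDiffOn ℝ ∞ (fibreDeriv Λ) W :=
  ((contDiffOn_fderiv hW hΛ).clm_comp contDiffOn_const).congr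
    fun _ hz => fibreDeriv_eq (differentiableAt_of_contDiffOn hW hΛ hz)

lemma contDiffOn_localMetric (hW : IsOpen W) (hΛ : ContDiffOn ℝ ∞ Λ W) :
    ContDiffOn ℝ ∞ (localMetric Λ) W := by
  have h := contDiffOn_fderiv hW (contDiffOn_fibreDeriv hW hΛ)
  refine (h.clm_comp (contDiffOn_const (c := ContinuousLinearMap.inr ℝ E E))).congr fun z hz => ?_
  have h1 : HasFDerivAt (fun w : E => (z.1, w)) (ContinuousLinearMap.inr ℝ E E) z.2 :=
    hasFDerivAt_prodMk_right z.1 z.2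
  have h3 : HasFDerivAt (fibreDeriv Λ) (fderiv ℝ (fibreDeriv Λ) z) (z.1, z.2) :=
    (differentiableAt_of_contDiffOn hW (contDiffOn_fibreDeriv hW hΛ) hz).hasFDerivAt
  exact (HasFDerivAt.comp (g := fibreDeriv Λ) z.2 h3 h1).fderiv

lemma contDiffOn_lagrangeCovector (hW : IsOpen W) (hΛ : ContDiffOn ℝ ∞ Λ W) :
    ContDiffOn ℝ ∞ (lagrangeCovector Λ) W := by
  have h := contDiffOn_fderiv hW (contDiffOn_fibreDeriv hW hΛ)
  have h0 := contDiffOn_fderiv hW hΛ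
  have hv : ContDiffOn ℝ ∞ (fun z : E × E => ((z.2, 0) : E × E)) W :=
    (contDiff_snd.prodMk contDiff_const).contDiffOn
  refine ((h.clm_apply hv).sub
    (h0.clm_comp (contDiffOn_const (c := ContinuousLinearMap.inl ℝ E E)))).congr fun z hz => ?_
  have h1 : HasFDerivAt (fun y : E => (y, z.2)) (ContinuousLinearMap.inl ℝ E E) z.1 :=
    hasFDerivAt_prodMk_left z.1 z.2
  have h3 : HasFDerivAt (fibreDeriv Λ) (fderiv ℝ (fibreDeriv Λ) z) (z.1, z.2) :=
    (differentiableAt_of_contDiffOn hW (contDiffOn_fibreDeriv hW hΛ) hz).hasFDerivAt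
  have h5 : HasFDerivAt Λ (fderiv ℝ Λ z) (z.1, z.2) :=
    (differentiableAt_of_contDiffOn hW hΛ hz).hasFDerivAt
  have h6 : HasFDerivAt (fun y => Λ (y, z.2)) _ z.1 := HasFDerivAt.comp (g := Λ) z.1 h5 h1
  have h7 : HasFDerivAt (fun y => fibreDeriv Λ (y, z.2)) _ z.1 :=
    HasFDerivAt.comp (g := fibreDeriv Λ) z.1 h3 h1
  rw [lagrangeCovector, h6.fderiv, h7.fderiv]
  simp

end Smooth

/-- An injective map from `E` to its dual is bijective by equality of dimensions. Without this,
`ContinuousLinearMap.inverse` in `spray` would be its default value zero. -/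
lemma isInvertible_of_nondegenerate [FiniteDimensional ℝ E] {B : E →L[ℝ] E →L[ℝ] ℝ}
    (hB : ∀ u, (∀ w, B u w = 0) → u = 0) : B.IsInvertible := by
  have hinj : Function.Injective (B : E →ₗ[ℝ] E →L[ℝ] ℝ) := by
    refine (injective_iff_map_eq_zero _).2 fun u hu => hB u fun w => ?_
    have : B u = 0 := hu
    simp [this]
  have hdim : Module.finrank ℝ E = Module.finrank ℝ (E →L[ℝ] ℝ) := by
    rw [← Subspace.dual_finrank_eq (K := ℝ) (V := E)]
    exact (LinearMap.toContinuousLinearMap (𝕜 := ℝ) (E := E) (F' := ℝ)).finrank_eq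
  exact ⟨(LinearMap.linearEquivOfInjective _ hinj hdim).toContinuousLinearEquiv, by ext; rfl⟩

/-- A vector in the radical is orthogonal to the timelike `t`, so if non-zero it would satisfy `B u
u > 0`. -/
lemma IsLorentzian.nondegenerate {B : E →L[ℝ] E →L[ℝ] ℝ} (hB : IsLorentzian B) (u : E)
    (hu : ∀ w, B u w = 0) : u = 0 := by
  obtain ⟨hsymm, t, -, ht⟩ := hB
  by_contra hne
  exact (ht u (by rw [hsymm, hu]) hne).ne' (hu u)

namespace IsFinslerOn

variable {Λ : E × E → ℝ} {W : Set (E × E)} {z : E × E}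

/-- The Euler-Lagrange equation for the acceleration `-2G`. -/
lemma eulerLagrange_spray [FiniteDimensional ℝ E] (h : IsFinslerOn Λ W) (hz : z ∈ W) (w : E) :
    fderiv ℝ (fderiv ℝ Λ) z (z.2, -((2 : ℝ) • spray Λ z)) (0, w) = fderiv ℝ Λ z (w, 0) := by
  have hinv := isInvertible_of_nondegenerate (h.nondegenerate z hz)
  have h1 : localMetric Λ z ((2 : ℝ) • spray Λ z) = lagrangeCovector Λ z := by
    rw [spray, smul_smul]
    norm_num
    exact ((hinv.inverse_apply_eq).1 rfl).symm
  have h2 := congrArg (fun B => B w) h1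
  simp only [localMetric_apply h.isOpen h.contDiffOn hz,
    lagrangeCovector_apply h.isOpen h.contDiffOn hz] at h2
  have h3 : (z.2, -((2 : ℝ) • spray Λ z)) = (z.2, (0 : E)) - (0, (2 : ℝ) • spray Λ z) := by simp
  rw [h3, map_sub, sub_apply, h2]
  ring

/-- The acceleration that solves the Euler-Lagrange equation is unique. -/
lemma eq_spray [FiniteDimensional ℝ E] (h : IsFinslerOn Λ W) (hz : z ∈ W) {a : E}
    (ha : ∀ w, fderiv ℝ (fderiv ℝ Λ) z (z.2, -a) (0, w) = fderiv ℝ Λ z (w, 0)) :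
    a = (2 : ℝ) • spray Λ z := by
  refine sub_eq_zero.1 (h.nondegenerate z hz _ fun w => ?_)
  rw [localMetric_apply h.isOpen h.contDiffOn hz]
  have h3 : ((0 : E), a - (2 : ℝ) • spray Λ z)
      = (z.2, -((2 : ℝ) • spray Λ z)) - (z.2, -a) := by
    ext <;> simp; abel
  rw [h3, map_sub, sub_apply, h.eulerLagrange_spray hz, ha, sub_self]

lemma contDiffOn_spray [FiniteDimensional ℝ E] (h : IsFinslerOn Λ W) : ContDiffOn ℝ ∞ (spray Λ) W := by
  intro z hz
  have h1 : ContDiffAt ℝ ∞ (ContinuousLinearMap.inverse (R := ℝ)) (localMetric Λ z) :=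
    (isInvertible_of_nondegenerate (h.nondegenerate z hz)).contDiffAt_map_inverse
  have h2 := contDiffOn_localMetric h.isOpen h.contDiffOn z hz
  exact ((h1.comp_contDiffWithinAt z h2).clm_apply
    (contDiffOn_lagrangeCovector h.isOpen h.contDiffOn z hz)).const_smul (1 / 2 : ℝ)

lemma nonlinConn_eq [FiniteDimensional ℝ E] (h : IsFinslerOn Λ W) (hz : z ∈ W) :
    nonlinConn Λ z = (fderiv ℝ (spray Λ) z).comp (ContinuousLinearMap.inr ℝ E E) := by
  have h1 : HasFDerivAt (fun w : E => (z.1, w)) (ContinuousLinearMap.inr ℝ E E) z.2 :=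
    hasFDerivAt_prodMk_right z.1 z.2
  have h3 : HasFDerivAt (spray Λ) (fderiv ℝ (spray Λ) z) (z.1, z.2) :=
    (differentiableAt_of_contDiffOn h.isOpen h.contDiffOn_spray hz).hasFDerivAt
  exact (HasFDerivAt.comp (g := spray Λ) z.2 h3 h1).fderiv

lemma nonlinConn_apply [FiniteDimensional ℝ E] (h : IsFinslerOn Λ W) (hz : z ∈ W) (w : E) :
    nonlinConn Λ z w = fderiv ℝ (spray Λ) z (0, w) := by
  rw [h.nonlinConn_eq hz]; simp

lemma contDiffOn_nonlinConn [FiniteDimensional ℝ E] (h : IsFinslerOn Λ W) : ContDiffOn ℝ ∞ (nonlinConn Λ) W :=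
  ((contDiffOn_fderiv h.isOpen h.contDiffOn_spray).clm_comp contDiffOn_const).congr
    fun _ hz => h.nonlinConn_eq hz

/-- Scaling of velocities. -/
def velocityScale (E : Type*) [NormedAddCommGroup E] [NormedSpace ℝ E] (s : ℝ) :
    E × E →L[ℝ] E × E :=
  (ContinuousLinearMap.id ℝ E).prodMap (s • ContinuousLinearMap.id ℝ E)

@[simp] lemma velocityScale_apply (s : ℝ) (z : E × E) : velocityScale E s z = (z.1, s • z.2) := rfl

lemma fderiv_velocityScale (h : IsFinslerOn Λ W) (hz : z ∈ W) {s : ℝ} (hs : 0 < s) :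
    (fderiv ℝ Λ (z.1, s • z.2)).comp (velocityScale E s) = s ^ 2 • fderiv ℝ Λ z := by
  have h1 := differentiableAt_of_contDiffOn h.isOpen h.contDiffOn (h.conic z hz s hs)
  have h2 : HasFDerivAt (Λ ∘ velocityScale E s)
      ((fderiv ℝ Λ (z.1, s • z.2)).comp (velocityScale E s)) z :=
    HasFDerivAt.comp z (by exact h1.hasFDerivAt) (velocityScale E s).hasFDerivAt
  have h3 : HasFDerivAt (fun z => s ^ 2 * Λ z) (s ^ 2 • fderiv ℝ Λ z) z :=
    (differentiableAt_of_contDiffOn h.isOpen h.contDiffOn hz).hasFDerivAt.const_mul _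
  refine h2.unique (h3.congr_of_eventuallyEq ?_)
  filter_upwards [h.isOpen.mem_nhds hz] with y hy
  exact h.homogeneous y hy s hs

lemma fderiv_fderiv_velocityScale (h : IsFinslerOn Λ W) (hz : z ∈ W) {s : ℝ} (hs : 0 < s)
    (a b : E × E) :
    fderiv ℝ (fderiv ℝ Λ) (z.1, s • z.2) (a.1, s • a.2) (b.1, s • b.2)
      = s ^ 2 * fderiv ℝ (fderiv ℝ Λ) z a b := by
  have h0 := contDiffOn_fderiv h.isOpen h.contDiffOn
  have h1 := differentiableAt_of_contDiffOn h.isOpen h0 (h.conic z hz s hs)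
  have h2 : HasFDerivAt (fun z => (fderiv ℝ Λ (velocityScale E s z)).comp (velocityScale E s)) _ z :=
    (HasFDerivAt.comp z (by exact h1.hasFDerivAt) (velocityScale E s).hasFDerivAt).clm_comp
      (hasFDerivAt_const (velocityScale E s) z)
  have h3 : HasFDerivAt (s ^ 2 • fderiv ℝ Λ) (s ^ 2 • fderiv ℝ (fderiv ℝ Λ) z) z :=
    (differentiableAt_of_contDiffOn h.isOpen h0 hz).hasFDerivAt.const_smul _
  have h4 := h2.unique (h3.congr_of_eventuallyEq (by
    filter_upwards [h.isOpen.mem_nhds hz] with y hy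
    exact h.fderiv_velocityScale hy hs))
  have h5 := congrArg (fun B => B a b) h4
  simpa using h5

lemma spray_smul [FiniteDimensional ℝ E] (h : IsFinslerOn Λ W) (hz : z ∈ W) {s : ℝ} (hs : 0 < s) :
    spray Λ (z.1, s • z.2) = s ^ 2 • spray Λ z := by
  have key : s ^ 2 • (2 : ℝ) • spray Λ z = (2 : ℝ) • spray Λ (z.1, s • z.2) := by
    refine h.eq_spray (h.conic z hz s hs) fun w => ?_
    -- The factors `s` and `s⁻¹` are chosen so that the scaled vectors are `(s v, -s² 2G)` and `(0,
    -- w)`, as in the Euler-Lagrange equation at `(x, s v)`.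
    have h1 := h.fderiv_fderiv_velocityScale hz hs (s • (z.2, -((2 : ℝ) • spray Λ z)))
      (s⁻¹ • ((0 : E), w))
    have h2 := congrArg (fun B => B (w, (0 : E))) (h.fderiv_velocityScale hz hs)
    simp only [ContinuousLinearMap.comp_apply, velocityScale_apply, smul_zero,
      smul_apply, smul_eq_mul] at h2
    rw [map_smul, map_smul, smul_apply, h.eulerLagrange_spray hz, smul_smul,
      inv_mul_cancel₀ hs.ne', one_smul, ← h2] at h1
    rw [← h1]
    simp [smul_smul, mul_inv_cancel₀ hs.ne', pow_two, mul_assoc]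
  rw [smul_comm] at key
  exact (smul_right_injective E (two_ne_zero (α := ℝ)) key).symm

/-- Euler's relation for functions that are homogeneous of degree two in the velocity. -/
lemma euler_relation {Y : Type*} [NormedAddCommGroup Y] [NormedSpace ℝ Y] {f : E × E → Y}
    (hf : DifferentiableAt ℝ f z) (hom : ∀ s : ℝ, 0 < s → f (z.1, s • z.2) = s ^ 2 • f z) :
    fderiv ℝ f z (0, z.2) = (2 : ℝ) • f z := by
  have h1 : HasDerivAt (fun s : ℝ => (z.1, s • z.2)) ((0 : E), z.2) 1 := by
    have := ((hasDerivAt_id (1 : ℝ)).smul_const z.2)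
    simpa using (hasDerivAt_const (1 : ℝ) z.1).prodMk this
  have h2 : HasDerivAt (fun s : ℝ => f (z.1, s • z.2)) (fderiv ℝ f z (0, z.2)) 1 :=
    HasFDerivAt.comp_hasDerivAt (l := f) (l' := fderiv ℝ f z) 1
      (by simpa using hf.hasFDerivAt) h1
  have h3 : HasDerivAt (fun s : ℝ => s ^ 2 • f z) ((2 : ℝ) • f z) 1 := by
    simpa using (hasDerivAt_pow 2 (1 : ℝ)).smul_const (f z)
  refine h2.unique (h3.congr_of_eventuallyEq ?_)
  filter_upwards [lt_mem_nhds (zero_lt_one (α := ℝ))] with s hs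
  exact hom s hs

/-- The derivative of Euler's relation. -/
lemma euler_relation_fderiv {Y : Type*} [NormedAddCommGroup Y] [NormedSpace ℝ Y] {f : E × E → Y}
    (hW : IsOpen W) (hf : ContDiffOn ℝ ∞ f W)
    (hom : ∀ z ∈ W, ∀ s : ℝ, 0 < s → f (z.1, s • z.2) = s ^ 2 • f z) (hz : z ∈ W) (a : E × E) :
    fderiv ℝ (fderiv ℝ f) z a (0, z.2) + fderiv ℝ f z (0, a.2) = (2 : ℝ) • fderiv ℝ f z a := by
  have h0 := differentiableAt_of_contDiffOn hW (contDiffOn_fderiv hW hf) hz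
  have h1 : HasFDerivAt (fun z : E × E => ((0 : E), z.2))
      ((ContinuousLinearMap.inr ℝ E E).comp (ContinuousLinearMap.snd ℝ E E)) z :=
    ((ContinuousLinearMap.inr ℝ E E).comp (ContinuousLinearMap.snd ℝ E E)).hasFDerivAt
  have h2 := h0.hasFDerivAt.clm_apply h1
  have h3 := (differentiableAt_of_contDiffOn hW hf hz).hasFDerivAt.const_smul (2 : ℝ)
  have h4 := h2.unique (h3.congr_of_eventuallyEq (by
    filter_upwards [hW.mem_nhds hz] with y hy
    exact euler_relation (differentiableAt_of_contDiffOn hW hf hy) (hom y hy)))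
  have h5 := congrArg (fun B => B a) h4
  simp only [add_apply, ContinuousLinearMap.comp_apply,
    ContinuousLinearMap.flip_apply, smul_apply,
    ContinuousLinearMap.inr_apply, ContinuousLinearMap.coe_snd'] at h5
  rw [← h5, add_comm]

/-- The connection coefficients are homogeneous of degree one. -/
lemma fderiv_nonlinConn_velocity [FiniteDimensional ℝ E] (h : IsFinslerOn Λ W) (hz : z ∈ W) (w : E) :
    fderiv ℝ (nonlinConn Λ) z (0, z.2) w = nonlinConn Λ z w := by
  have hG := h.contDiffOn_spray
  have h1 := (differentiableAt_of_contDiffOn h.isOpen (contDiffOn_fderiv h.isOpen hG)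
    hz).hasFDerivAt.clm_comp (hasFDerivAt_const (ContinuousLinearMap.inr ℝ E E) z)
  have h2 := h1.congr_of_eventuallyEq (f₁ := nonlinConn Λ) (by
    filter_upwards [h.isOpen.mem_nhds hz] with y hy
    exact h.nonlinConn_eq hy)
  -- Euler's relation for `G`, differentiated in the fibre: one of the two copies of `N w` on the
  -- right cancels, which lowers the degree from two to one.
  have h3 := euler_relation_fderiv h.isOpen hG (fun z hz s hs => h.spray_smul hz hs) hz (0, w)
  rw [fderiv_fderiv_symm (hG.contDiffAt (h.isOpen.mem_nhds hz)) ENat.LEInfty.out,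
    two_smul, add_left_inj] at h3
  rw [h2.fderiv, h.nonlinConn_apply hz, ← h3]
  simp

/-- Differentiated Euler relation for `Λ`. It identifies `ker g_v(v, ·)` with the kernel of the
fibre differential of the Lagrangian. -/
lemma localMetric_velocity (h : IsFinslerOn Λ W) (hz : z ∈ W) (w : E) :
    localMetric Λ z z.2 w = fderiv ℝ Λ z (0, w) := by
  have h3 := euler_relation_fderiv h.isOpen h.contDiffOn
    (fun z hz s hs => h.homogeneous z hz s hs) hz (0, w)
  rw [fderiv_fderiv_symm (h.contDiffOn.contDiffAt (h.isOpen.mem_nhds hz))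
    ENat.LEInfty.out, two_smul, add_left_inj] at h3
  rw [localMetric_apply h.isOpen h.contDiffOn hz, h3]

/-- Conservation of the Lagrangian along geodesics: the Euler-Lagrange equation tested on the
velocity is compared with Euler's relation differentiated along `(v, -2G)`. -/
lemma fderiv_spray_direction [FiniteDimensional ℝ E] (h : IsFinslerOn Λ W) (hz : z ∈ W) :
    (2 : ℝ) • fderiv ℝ Λ z (0, spray Λ z) = fderiv ℝ Λ z (z.2, 0) := by
  have h1 := h.eulerLagrange_spray hz z.2
  have h3 := euler_relation_fderiv h.isOpen h.contDiffOn
    (fun z hz s hs => h.homogeneous z hz s hs) hz (z.2, -((2 : ℝ) • spray Λ z))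
  have h4 : (z.2, -((2 : ℝ) • spray Λ z)) = (z.2, (0 : E)) - (2 : ℝ) • (0, spray Λ z) := by simp
  have h5 : ((0 : E), -((2 : ℝ) • spray Λ z)) = -((2 : ℝ) • (0, spray Λ z)) := by simp
  rw [h1, h5, h4, map_neg, map_sub, map_smul] at h3
  simp only [smul_eq_mul] at h3 ⊢
  linarith

/-- The Lagrangian is constant along horizontal directions. -/
lemma fderiv_horizontal [FiniteDimensional ℝ E] (h : IsFinslerOn Λ W) (hz : z ∈ W) (w : E) :
    fderiv ℝ Λ z (w, -(nonlinConn Λ z w)) = 0 := by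
  have hD := (differentiableAt_of_contDiffOn h.isOpen
    (contDiffOn_fderiv h.isOpen h.contDiffOn) hz).hasFDerivAt
  have hG := (differentiableAt_of_contDiffOn h.isOpen h.contDiffOn_spray hz).hasFDerivAt
  have h1 := (hD.clm_apply ((ContinuousLinearMap.inr ℝ E E).hasFDerivAt.comp z hG)).const_smul
    (2 : ℝ)
  have h2 : HasFDerivAt (fun z : E × E => (z.2, (0 : E)))
      ((ContinuousLinearMap.inl ℝ E E).comp (ContinuousLinearMap.snd ℝ E E)) z :=
    ((ContinuousLinearMap.inl ℝ E E).comp (ContinuousLinearMap.snd ℝ E E)).hasFDerivAt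
  -- The conservation law `2 DΛ(0, G) = DΛ(v, 0)` is differentiated in the vertical direction `w`;
  -- the second-order terms are then eliminated by the Euler-Lagrange equation.
  have h4 := h1.unique ((hD.clm_apply h2).congr_of_eventuallyEq (by
    filter_upwards [h.isOpen.mem_nhds hz] with y hy
    exact h.fderiv_spray_direction hy))
  have h5 := congrArg (fun B => B ((0 : E), w)) h4
  simp only [add_apply, ContinuousLinearMap.comp_apply, Function.comp_apply,
    ContinuousLinearMap.flip_apply, smul_apply, ContinuousLinearMap.inl_apply,
    ContinuousLinearMap.inr_apply, ContinuousLinearMap.coe_snd', ← h.nonlinConn_apply hz,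
    smul_eq_mul] at h5
  have hsymm := fderiv_fderiv_symm (h.contDiffOn.contDiffAt (h.isOpen.mem_nhds hz))
    ENat.LEInfty.out
  have h6 := h.eulerLagrange_spray hz w
  have h7 : (z.2, -((2 : ℝ) • spray Λ z)) = (z.2, (0 : E)) - (2 : ℝ) • (0, spray Λ z) := by simp
  rw [h7, map_sub, map_smul, sub_apply, smul_apply,
    smul_eq_mul, hsymm (0, spray Λ z), hsymm (z.2, 0)] at h6
  have h8 : (w, -(nonlinConn Λ z w)) = (w, (0 : E)) - (0, nonlinConn Λ z w) := by simp
  rw [h8, map_sub]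
  linarith

/-- The curvature is tangent to the level sets of the Lagrangian in the fibres. -/
lemma fderiv_curvature [FiniteDimensional ℝ E] (h : IsFinslerOn Λ W) (hz : z ∈ W) (a b : E) :
    fderiv ℝ Λ z (0, localCurvature Λ z a b) = 0 := by
  have hD := (differentiableAt_of_contDiffOn h.isOpen
    (contDiffOn_fderiv h.isOpen h.contDiffOn) hz).hasFDerivAt
  have hN := (differentiableAt_of_contDiffOn h.isOpen h.contDiffOn_nonlinConn hz).hasFDerivAt
  have hsymm := fderiv_fderiv_symm (h.contDiffOn.contDiffAt (h.isOpen.mem_nhds hz))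
    ENat.LEInfty.out
  -- The identity `DΛ(b, -N b) = 0` is differentiated along the horizontal lift of `a`. The left
  -- side is symmetric in `a` and `b`, so antisymmetrizing the right side gives zero.
  have key : ∀ a b : E, fderiv ℝ (fderiv ℝ Λ) z (a, -(nonlinConn Λ z a)) (b, -(nonlinConn Λ z b))
      = fderiv ℝ Λ z (0, horDerivConn Λ z a b) := by
    intro a b
    have h1 : HasFDerivAt (fun y => (b, -(nonlinConn Λ y b))) _ z :=
      (hasFDerivAt_const b z).prodMk (hN.clm_apply (hasFDerivAt_const b z)).neg
    have h4 := (hD.clm_apply h1).unique ((hasFDerivAt_const (0 : ℝ) z).congr_of_eventuallyEq (by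
      filter_upwards [h.isOpen.mem_nhds hz] with y hy
      exact h.fderiv_horizontal hy b))
    have h5 := congrArg (fun B => B (a, -(nonlinConn Λ z a))) h4
    simp only [add_apply, ContinuousLinearMap.comp_apply,
      ContinuousLinearMap.flip_apply, ContinuousLinearMap.prod_apply,
      zero_apply, neg_apply, map_zero, zero_add] at h5
    have h6 : ((0 : E), -(horDerivConn Λ z a b)) = -((0 : E), horDerivConn Λ z a b) := by simp
    have h7 : horDerivConn Λ z a b
      = fderiv ℝ (nonlinConn Λ) z (a, -(nonlinConn Λ z a)) b := rfl
    rw [← h7, h6, map_neg] at h5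
    linarith
  have h8 : ((0 : E), localCurvature Λ z a b)
      = (0, horDerivConn Λ z a b) - (0, horDerivConn Λ z b a) := by
    ext <;> simp [localCurvature]
  rw [h8, map_sub, ← key, ← key, hsymm, sub_self]

end IsFinslerOn

end LocalCalculus

/-! ### Transformation laws under a change of coordinates. -/

section CoordinateChange

variable {E : Type*} [NormedAddCommGroup E] [NormedSpace ℝ E]

/-- The tangent map `(x, v) ↦ (φ x, dφ_x v)` of a change of coordinates. -/
noncomputable def velocityLift (φ : E → E) (z : E × E) : E × E := (φ z.1, fderiv ℝ φ z.1 z.2)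

/-- `φ` is a smooth map on a neighbourhood of the projection of the open set `W`, whose
tangent map sends `W` to the open set `W'` and `Λ'` to `Λ`. -/
structure IsLagrangianMap (φ : E → E) (O : Set E) (Λ : E × E → ℝ) (W : Set (E × E))
    (Λ' : E × E → ℝ) (W' : Set (E × E)) : Prop where
  isOpen_base : IsOpen O
  contDiffOn : ContDiffOn ℝ ∞ φ O
  isOpen_source : IsOpen W
  isOpen_target : IsOpen W'
  contDiffOn_source : ContDiffOn ℝ ∞ Λ W
  contDiffOn_target : ContDiffOn ℝ ∞ Λ' W'
  fst_mem : ∀ z ∈ W, z.1 ∈ O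
  mapsTo : ∀ z ∈ W, velocityLift φ z ∈ W'
  eq : ∀ z ∈ W, Λ z = Λ' (velocityLift φ z)

namespace IsLagrangianMap

variable {φ : E → E} {O : Set E} {Λ Λ' : E × E → ℝ} {W W' : Set (E × E)} {z : E × E}

lemma hasFDerivAt_fderiv (h : IsLagrangianMap φ O Λ W Λ' W') (hz : z ∈ W) :
    HasFDerivAt (fun z : E × E => fderiv ℝ φ z.1)
      ((fderiv ℝ (fderiv ℝ φ) z.1).comp (ContinuousLinearMap.fst ℝ E E)) z :=
  HasFDerivAt.comp (g := fderiv ℝ φ) z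
    (differentiableAt_of_contDiffOn h.isOpen_base (contDiffOn_fderiv h.isOpen_base h.contDiffOn)
      (h.fst_mem z hz)).hasFDerivAt hasFDerivAt_fst

lemma exists_hasFDerivAt_velocityLift (h : IsLagrangianMap φ O Λ W Λ' W') (hz : z ∈ W) :
    ∃ T : E × E →L[ℝ] E × E, HasFDerivAt (velocityLift φ) T z ∧
      ∀ a, T a = (fderiv ℝ φ z.1 a.1,
        fderiv ℝ φ z.1 a.2 + fderiv ℝ (fderiv ℝ φ) z.1 a.1 z.2) := by
  have h1 : HasFDerivAt (fun z : E × E => φ z.1)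
      ((fderiv ℝ φ z.1).comp (ContinuousLinearMap.fst ℝ E E)) z :=
    HasFDerivAt.comp (g := φ) z (differentiableAt_of_contDiffOn h.isOpen_base h.contDiffOn
      (h.fst_mem z hz)).hasFDerivAt hasFDerivAt_fst
  exact ⟨_, h1.prodMk ((h.hasFDerivAt_fderiv hz).clm_apply hasFDerivAt_snd), fun a => by simp⟩

lemma fderiv_apply (h : IsLagrangianMap φ O Λ W Λ' W') (hz : z ∈ W) (a : E × E) :
    fderiv ℝ Λ z a = fderiv ℝ Λ' (velocityLift φ z) (fderiv ℝ φ z.1 a.1,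
        fderiv ℝ φ z.1 a.2 + fderiv ℝ (fderiv ℝ φ) z.1 a.1 z.2) := by
  obtain ⟨T, hT, hTa⟩ := h.exists_hasFDerivAt_velocityLift hz
  have h1 := (differentiableAt_of_contDiffOn h.isOpen_target h.contDiffOn_target
    (h.mapsTo z hz)).hasFDerivAt.comp z hT
  have h2 := h1.congr_of_eventuallyEq (f₁ := Λ) (by
    filter_upwards [h.isOpen_source.mem_nhds hz] with y hy
    exact h.eq y hy)
  rw [h2.fderiv, ContinuousLinearMap.comp_apply, hTa]

/-- The last term arises because the lift of the vertical vector `(0, w)` is `(0, dφ_x w)`, which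
varies with the base point. It vanishes for vertical `a`, which makes the metric tensorial. -/
lemma fderiv_fderiv_apply (h : IsLagrangianMap φ O Λ W Λ' W') (hz : z ∈ W) (a : E × E) (w : E) :
    fderiv ℝ (fderiv ℝ Λ) z a (0, w)
      = fderiv ℝ (fderiv ℝ Λ') (velocityLift φ z) (fderiv ℝ φ z.1 a.1,
          fderiv ℝ φ z.1 a.2 + fderiv ℝ (fderiv ℝ φ) z.1 a.1 z.2) (0, fderiv ℝ φ z.1 w)
        + fderiv ℝ Λ' (velocityLift φ z) (0, fderiv ℝ (fderiv ℝ φ) z.1 a.1 w) := by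
  obtain ⟨T, hT, hTa⟩ := h.exists_hasFDerivAt_velocityLift hz
  have h1 : HasFDerivAt (fun y => fderiv ℝ Λ' (velocityLift φ y)) _ z :=
    HasFDerivAt.comp (g := fderiv ℝ Λ') z (differentiableAt_of_contDiffOn h.isOpen_target
      (contDiffOn_fderiv h.isOpen_target h.contDiffOn_target) (h.mapsTo z hz)).hasFDerivAt hT
  have h2 : HasFDerivAt (fun y : E × E => ((0 : E), fderiv ℝ φ y.1 w)) _ z :=
    (hasFDerivAt_const 0 z).prodMk
      ((h.hasFDerivAt_fderiv hz).clm_apply (hasFDerivAt_const w z))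
  have h3 := (differentiableAt_of_contDiffOn h.isOpen_source
    (contDiffOn_fderiv h.isOpen_source h.contDiffOn_source) hz).hasFDerivAt.clm_apply
      (hasFDerivAt_const ((0 : E), w) z)
  have h4 := h3.unique ((h1.clm_apply h2).congr_of_eventuallyEq (by
    filter_upwards [h.isOpen_source.mem_nhds hz] with y hy
    simpa using h.fderiv_apply hy (0, w)))
  have h5 := congrArg (fun B => B a) h4
  simp only [add_apply, ContinuousLinearMap.comp_apply, ContinuousLinearMap.flip_apply,
    ContinuousLinearMap.prod_apply, zero_apply, map_zero, zero_add, hTa,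
    ContinuousLinearMap.coe_fst'] at h5
  rw [h5, add_comm]

lemma localMetric_apply (h : IsLagrangianMap φ O Λ W Λ' W') (hz : z ∈ W) (u w : E) :
    localMetric Λ z u w
      = localMetric Λ' (velocityLift φ z) (fderiv ℝ φ z.1 u) (fderiv ℝ φ z.1 w) := by
  rw [LorentzFinsler.localMetric_apply h.isOpen_source h.contDiffOn_source hz,
    LorentzFinsler.localMetric_apply h.isOpen_target h.contDiffOn_target (h.mapsTo z hz),
    h.fderiv_fderiv_apply hz]
  simp [← Prod.zero_eq_mk]

/-- The transformation law of the spray. -/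
lemma spray_velocityLift [FiniteDimensional ℝ E] (h : IsLagrangianMap φ O Λ W Λ' W')
    (hΛ : IsFinslerOn Λ W) (hΛ' : IsFinslerOn Λ' W') (hz : z ∈ W)
    (hsurj : Function.Surjective (fderiv ℝ φ z.1)) :
    (2 : ℝ) • spray Λ' (velocityLift φ z)
      = (2 : ℝ) • fderiv ℝ φ z.1 (spray Λ z) - fderiv ℝ (fderiv ℝ φ) z.1 z.2 z.2 := by
  symm
  refine hΛ'.eq_spray (h.mapsTo z hz) fun w' => ?_
  obtain ⟨w, rfl⟩ := hsurj w'
  have h1 := hΛ.eulerLagrange_spray hz w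
  rw [h.fderiv_fderiv_apply hz, h.fderiv_apply hz] at h1
  have hsymm := fderiv_fderiv_symm (h.contDiffOn.contDiffAt (h.isOpen_base.mem_nhds
    (h.fst_mem z hz))) ENat.LEInfty.out
  -- By symmetry of `d²φ` the same term `DΛ'(0, d²φ(v, w))` stands on both sides of the
  -- Euler-Lagrange equation and cancels.
  have h2 : (fderiv ℝ φ z.1 w, fderiv ℝ φ z.1 0 + fderiv ℝ (fderiv ℝ φ) z.1 w z.2)
      = (fderiv ℝ φ z.1 w, (0 : E)) + (0, fderiv ℝ (fderiv ℝ φ) z.1 z.2 w) := by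
    simp [hsymm w]
  rw [h2, map_add, add_left_inj] at h1
  rw [← h1]
  simp only [velocityLift, map_neg, map_smul, neg_sub]
  congr 3
  abel

/-- The transformation law of the connection coefficients. -/
lemma nonlinConn_velocityLift [FiniteDimensional ℝ E] (h : IsLagrangianMap φ O Λ W Λ' W')
    (hΛ : IsFinslerOn Λ W) (hΛ' : IsFinslerOn Λ' W') (hz : z ∈ W)
    (hsurj : ∀ z ∈ W, Function.Surjective (fderiv ℝ φ z.1)) (w : E) :
    nonlinConn Λ' (velocityLift φ z) (fderiv ℝ φ z.1 w)
      = fderiv ℝ φ z.1 (nonlinConn Λ z w) - fderiv ℝ (fderiv ℝ φ) z.1 z.2 w := by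
  have hi : HasFDerivAt (fun v : E => (z.1, v)) (ContinuousLinearMap.inr ℝ E E) z.2 :=
    hasFDerivAt_prodMk_right z.1 z.2
  obtain ⟨T, hT, hTa⟩ := h.exists_hasFDerivAt_velocityLift hz
  have h1 : HasFDerivAt (fun v => velocityLift φ (z.1, v)) _ z.2 :=
    HasFDerivAt.comp (g := velocityLift φ) z.2 hT hi
  have h2 : HasFDerivAt (fun v => (2 : ℝ) • spray Λ' (velocityLift φ (z.1, v))) _ z.2 :=
    (HasFDerivAt.comp (g := spray Λ') z.2 (differentiableAt_of_contDiffOn h.isOpen_target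
      hΛ'.contDiffOn_spray (h.mapsTo z hz)).hasFDerivAt h1).const_smul (2 : ℝ)
  have h3 : HasFDerivAt (fun v => spray Λ (z.1, v)) _ z.2 :=
    HasFDerivAt.comp (g := spray Λ) z.2 (differentiableAt_of_contDiffOn h.isOpen_source
      hΛ.contDiffOn_spray hz).hasFDerivAt hi
  have h4 : HasFDerivAt (fun v => (2 : ℝ) • fderiv ℝ φ z.1 (spray Λ (z.1, v))) _ z.2 :=
    ((fderiv ℝ φ z.1).hasFDerivAt.comp z.2 h3).const_smul (2 : ℝ)
  have h5 : HasFDerivAt (fun v => fderiv ℝ (fderiv ℝ φ) z.1 v v) _ z.2 :=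
    (fderiv ℝ (fderiv ℝ φ) z.1).hasFDerivAt.clm_apply (hasFDerivAt_id z.2)
  -- The spray law is differentiated in the velocity at fixed position; the quadratic term `d²φ(v,
  -- v)` contributes `2 d²φ(v, w)`.
  have h6 := h2.unique ((h4.sub h5).congr_of_eventuallyEq (by
    filter_upwards [hi.continuousAt.preimage_mem_nhds (h.isOpen_source.mem_nhds hz)] with v hv
    exact h.spray_velocityLift hΛ hΛ' hv (hsurj _ hv)))
  have h7 := congrArg (fun B => B w) h6
  have hsymm := fderiv_fderiv_symm (h.contDiffOn.contDiffAt (h.isOpen_base.mem_nhds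
    (h.fst_mem z hz))) ENat.LEInfty.out
  simp only [smul_apply, sub_apply, add_apply, ContinuousLinearMap.comp_apply, hTa,
    ContinuousLinearMap.inr_apply, map_zero, zero_apply, add_zero,
    ContinuousLinearMap.flip_apply, ContinuousLinearMap.id_apply,
    ← hΛ.nonlinConn_apply hz, ← hΛ'.nonlinConn_apply (h.mapsTo z hz), hsymm w] at h7
  rw [← two_smul ℝ (fderiv ℝ (fderiv ℝ φ) z.1 z.2 w), ← smul_sub] at h7
  exact smul_right_injective E (two_ne_zero (α := ℝ)) h7

/-- The coordinate expression of the covariant derivative of a field `s` along `x` transforms as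
a vector. -/
lemma covDeriv_velocityLift [FiniteDimensional ℝ E]
    {F : Type*} [NormedAddCommGroup F] [NormedSpace ℝ F]
    (h : IsLagrangianMap φ O Λ W Λ' W')
    (hΛ : IsFinslerOn Λ W) (hΛ' : IsFinslerOn Λ' W')
    (hsurj : ∀ z ∈ W, Function.Surjective (fderiv ℝ φ z.1))
    {x s : F → E} {y : F} (hx : DifferentiableAt ℝ x y) (hs : DifferentiableAt ℝ s y)
    (hz : (x y, s y) ∈ W) (ξ : F) :
    fderiv ℝ (fun y => fderiv ℝ φ (x y) (s y)) y ξ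
        + nonlinConn Λ' (velocityLift φ (x y, s y)) (fderiv ℝ (φ ∘ x) y ξ)
      = fderiv ℝ φ (x y) (fderiv ℝ s y ξ + nonlinConn Λ (x y, s y) (fderiv ℝ x y ξ)) := by
  have hO := h.fst_mem _ hz
  have h1 := (differentiableAt_of_contDiffOn h.isOpen_base h.contDiffOn hO).hasFDerivAt
  have h2 : HasFDerivAt (fun y => fderiv ℝ φ (x y)) _ y :=
    HasFDerivAt.comp (g := fderiv ℝ φ) y (differentiableAt_of_contDiffOn h.isOpen_base
    (contDiffOn_fderiv h.isOpen_base h.contDiffOn) hO).hasFDerivAt hx.hasFDerivAt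
  have hsymm := fderiv_fderiv_symm (h.contDiffOn.contDiffAt (h.isOpen_base.mem_nhds hO))
    ENat.LEInfty.out
  -- The term `d²φ(dx ξ, s)` of the product rule cancels the inhomogeneous term in the law for `N`.
  rw [(h1.comp y hx.hasFDerivAt).fderiv, (h2.clm_apply hs.hasFDerivAt).fderiv,
    ContinuousLinearMap.comp_apply, h.nonlinConn_velocityLift hΛ hΛ' hz hsurj]
  simp [hsymm (s y)]

end IsLagrangianMap

end CoordinateChange

/-! ### The curvature identity in a chart, and the trace of a map adapted to a hyperplane. -/

section LocalCurvature

variable {E : Type*} [NormedAddCommGroup E] [NormedSpace ℝ E]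
  {F : Type*} [NormedAddCommGroup F] [NormedSpace ℝ F]
  {Λ : E × E → ℝ} {W : Set (E × E)} {x s : F → E} {y₀ : F} {θ : F → F →L[ℝ] ℝ}

lemma IsFinslerOn.contDiffAt_covDeriv [FiniteDimensional ℝ E] (h : IsFinslerOn Λ W) (hx : ContDiffAt ℝ 2 x y₀)
    (hs : ContDiffAt ℝ 2 s y₀) (hz : (x y₀, s y₀) ∈ W) :
    ContDiffAt ℝ 1
      (fun y => fderiv ℝ s y + (nonlinConn Λ (x y, s y)).comp (fderiv ℝ x y)) y₀ := by
  have h1 : ContDiffAt ℝ 1 (fderiv ℝ s) y₀ := hs.fderiv_right (by norm_num)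
  have h2 : ContDiffAt ℝ 1 (fderiv ℝ x) y₀ := hx.fderiv_right (by norm_num)
  have h3 : ContDiffAt ℝ 1 (nonlinConn Λ) (x y₀, s y₀) :=
    (h.contDiffOn_nonlinConn.contDiffAt (h.isOpen.mem_nhds hz)).of_le ENat.LEInfty.out
  have h4 : ContDiffAt ℝ 1 (fun y => (x y, s y)) y₀ :=
    (hx.prodMk hs).of_le (by norm_num)
  exact h1.add ((ContDiffAt.comp (g := nonlinConn Λ) y₀ h3 h4).clm_comp h2)

/-- With a functional `ℓ` such that `ℓ (s y₀) ≠ 0`, one has `θ = ℓ ∘ A / ℓ(s)` near `y₀`. -/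
lemma contDiffAt_of_smulRight_eq {A : F → F →L[ℝ] E} (hA : ContDiffAt ℝ 1 A y₀)
    (hs : ContDiffAt ℝ 1 s y₀) (hs0 : s y₀ ≠ 0)
    (hθ : ∀ᶠ y in nhds y₀, ∀ ξ, A y ξ = θ y ξ • s y) : ContDiffAt ℝ 1 θ y₀ := by
  obtain ⟨ℓ, hℓ⟩ := SeparatingDual.exists_ne_zero (R := ℝ) hs0
  have h1 : ContDiffAt ℝ 1 (fun y => ℓ (s y)) y₀ := ℓ.contDiff.contDiffAt.comp y₀ hs
  have h2 : ContDiffAt ℝ 1 (fun y => (ℓ (s y))⁻¹ • ℓ.comp (A y)) y₀ :=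
    (h1.inv hℓ).smul (contDiffAt_const.clm_comp hA)
  refine h2.congr_of_eventuallyEq ?_
  filter_upwards [hθ, h1.continuousAt.eventually_ne hℓ] with y hy hy0
  ext ξ
  simp [hy, mul_comm (θ y ξ), ← mul_assoc, inv_mul_cancel₀ hy0]

/-- If the covariant derivative of `s` along `x` is `θ ⊗ s`, then the curvature along `x` is
`dθ ⊗ s`. -/
lemma IsFinslerOn.localCurvature_eq [FiniteDimensional ℝ E] (h : IsFinslerOn Λ W) (hx : ContDiffAt ℝ 2 x y₀)
    (hs : ContDiffAt ℝ 2 s y₀) (hz : (x y₀, s y₀) ∈ W) (hθd : DifferentiableAt ℝ θ y₀)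
    (hθ : ∀ᶠ y in nhds y₀, ∀ ξ,
      fderiv ℝ s y ξ + nonlinConn Λ (x y, s y) (fderiv ℝ x y ξ) = θ y ξ • s y) (ξ η : F) :
    localCurvature Λ (x y₀, s y₀) (fderiv ℝ x y₀ ξ) (fderiv ℝ x y₀ η)
      = (fderiv ℝ θ y₀ ξ η - fderiv ℝ θ y₀ η ξ) • s y₀ := by
  have hsd := (hs.differentiableAt (by norm_num)).hasFDerivAt
  have hxd := (hx.differentiableAt (by norm_num)).hasFDerivAt
  have hs2 := ((hs.fderiv_right (m := 1) (by norm_num)).differentiableAt (by norm_num)).hasFDerivAt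
  have hx2 := ((hx.fderiv_right (m := 1) (by norm_num)).differentiableAt (by norm_num)).hasFDerivAt
  have hN := (differentiableAt_of_contDiffOn h.isOpen h.contDiffOn_nonlinConn hz).hasFDerivAt
  have hNc : HasFDerivAt (fun y => nonlinConn Λ (x y, s y)) _ y₀ :=
    HasFDerivAt.comp (g := nonlinConn Λ) y₀ hN (hxd.prodMk hsd)
  -- The equation `ds + N dx = θ ⊗ s`, tested on a constant `ξ` and differentiated in the direction
  -- `η`.
  have key : ∀ ξ η : F, fderiv ℝ (fderiv ℝ s) y₀ η ξ
      + (nonlinConn Λ (x y₀, s y₀) (fderiv ℝ (fderiv ℝ x) y₀ η ξ)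
        + fderiv ℝ (nonlinConn Λ) (x y₀, s y₀) (fderiv ℝ x y₀ η, fderiv ℝ s y₀ η)
          (fderiv ℝ x y₀ ξ))
      = θ y₀ ξ • fderiv ℝ s y₀ η + fderiv ℝ θ y₀ η ξ • s y₀ := by
    intro ξ η
    have h1 := (hs2.clm_apply (hasFDerivAt_const ξ y₀)).add
      (hNc.clm_apply (hx2.clm_apply (hasFDerivAt_const ξ y₀)))
    have h2 := (hθd.hasFDerivAt.clm_apply (hasFDerivAt_const ξ y₀)).smul hsd
    have h3 := h1.unique (h2.congr_of_eventuallyEq (hθ.mono fun y hy => hy ξ))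
    have h4 := congrArg (fun B => B η) h3
    simpa using h4
  -- Since `ds η = θ(η) s - N(dx η)`, the direction is horizontal up to `θ(η) (0, s)`, on which
  -- homogeneity of degree one returns `N`.
  have split : ∀ ξ η : F, fderiv ℝ (nonlinConn Λ) (x y₀, s y₀)
        (fderiv ℝ x y₀ η, fderiv ℝ s y₀ η) (fderiv ℝ x y₀ ξ)
      = horDerivConn Λ (x y₀, s y₀) (fderiv ℝ x y₀ η) (fderiv ℝ x y₀ ξ)
        + θ y₀ η • nonlinConn Λ (x y₀, s y₀) (fderiv ℝ x y₀ ξ) := by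
    intro ξ η
    have h1 : (fderiv ℝ x y₀ η, fderiv ℝ s y₀ η)
        = (fderiv ℝ x y₀ η, -(nonlinConn Λ (x y₀, s y₀) (fderiv ℝ x y₀ η)))
          + θ y₀ η • ((0 : E), s y₀) := by
      ext
      · simp
      · simp [← hθ.self_of_nhds η]
    rw [h1, map_add, map_smul, add_apply, smul_apply,
      h.fderiv_nonlinConn_velocity hz]
    rfl
  have hss := fderiv_fderiv_symm hs le_rfl ξ η
  have hxs := fderiv_fderiv_symm hx le_rfl ξ η
  have k1 := key ξ η
  have k2 := key η ξ
  have e1 := eq_sub_of_add_eq (hθ.self_of_nhds ξ)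
  have e2 := eq_sub_of_add_eq (hθ.self_of_nhds η)
  rw [split, e2] at k1
  rw [split, e1, hss, hxs] at k2
  have h5 : localCurvature Λ (x y₀, s y₀) (fderiv ℝ x y₀ ξ) (fderiv ℝ x y₀ η)
      = horDerivConn Λ (x y₀, s y₀) (fderiv ℝ x y₀ ξ) (fderiv ℝ x y₀ η)
        - horDerivConn Λ (x y₀, s y₀) (fderiv ℝ x y₀ η) (fderiv ℝ x y₀ ξ) := rfl
  rw [h5]
  -- The terms `θ(ξ) θ(η) s` and `θ(η) N(dx ξ) + θ(ξ) N(dx η)` are symmetric and drop out with the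
  -- second derivatives.
  linear_combination (norm := module) k2 - k1

/-- The trace of an endomorphism that maps the hyperplane `ker ℓ = range j` to the line of `j k`
and has its values in `ker ℓ`. -/
lemma trace_eq_of_map_hyperplane {E F : Type*} [AddCommGroup E] [Module ℝ E]
    [FiniteDimensional ℝ E] [AddCommGroup F] [Module ℝ F] (A : E →ₗ[ℝ] E) (j : F →ₗ[ℝ] E)
    (hj : Function.Injective j) (ℓ : E →ₗ[ℝ] ℝ) (hℓ : ℓ ≠ 0) (hker : ℓ.ker = j.range)
    (hA : ∀ u, ℓ (A u) = 0) (k : F) (c : F →ₗ[ℝ] ℝ) (hc : ∀ X, A (j X) = c X • j k) :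
    LinearMap.trace ℝ E A = c k := by
  obtain ⟨e', he'⟩ : ∃ e, ℓ e ≠ 0 := by
    by_contra! hcon
    exact hℓ (LinearMap.ext hcon)
  set e := (ℓ e')⁻¹ • e' with he
  have hℓe : ℓ e = 1 := by simp [he, he']
  obtain ⟨π, hπ⟩ := j.exists_leftInverse_of_injective (LinearMap.ker_eq_bot.2 hj)
  have hπj : ∀ X, π (j X) = X := fun X => LinearMap.congr_fun hπ X
  have hker' : ∀ X, ℓ (j X) = 0 := fun X => by
    have : j X ∈ ℓ.ker := hker ▸ ⟨X, rfl⟩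
    exact this
  -- Splitting `u` into its hyperplane part and `ℓ(u) e` writes `A` as a sum of two rank-one maps,
  -- with traces `c k` and `ℓ (A e) = 0`.
  have hAeq : A = (c.comp (π.comp (LinearMap.id - ℓ.smulRight e))).smulRight (j k)
      + ℓ.smulRight (A e) := by
    ext u
    have hu : u - ℓ u • e ∈ j.range := by
      rw [← hker]; simp [hℓe]
    obtain ⟨X, hX⟩ := hu
    have h1 : A u = A (j X) + ℓ u • A e := by rw [hX]; simp
    simp only [LinearMap.add_apply, LinearMap.smulRight_apply, LinearMap.comp_apply,
      LinearMap.sub_apply, LinearMap.id_apply]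
    rw [h1, ← hX, hπj, hc]
  rw [hAeq, map_add, LinearMap.trace_smulRight, LinearMap.trace_smulRight, hA, add_zero]
  simp [hker', hπj]

end LocalCurvature

/-! ### Charts of the manifold and of its tangent bundle. -/

section Charts

variable {E : Type*} [NormedAddCommGroup E] [NormedSpace ℝ E]
  {M : Type*} [TopologicalSpace M] [ChartedSpace E M]

/-- The transition map between the preferred charts at `p` and `p'`. -/
noncomputable def transition (p p' : M) : E → E := extChartAt 𝓘(ℝ, E) p' ∘ (extChartAt 𝓘(ℝ, E) p).symm

/-- The domain of the transition map. -/
def transitionDomain (p p' : M) : Set E :=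
  ((extChartAt 𝓘(ℝ, E) p).symm ≫ extChartAt 𝓘(ℝ, E) p').source

lemma mem_transitionDomain {p p' : M} {x : E} : x ∈ transitionDomain p p' ↔
    x ∈ (extChartAt 𝓘(ℝ, E) p).target ∧
      (extChartAt 𝓘(ℝ, E) p).symm x ∈ (extChartAt 𝓘(ℝ, E) p').source := by
  simp only [transitionDomain, PartialEquiv.trans_source, PartialEquiv.symm_source,
    Set.mem_inter_iff, Set.mem_preimage]

lemma isOpen_transitionDomain (p p' : M) : IsOpen (transitionDomain (E := E) p p') := by
  rw [transitionDomain, PartialEquiv.trans_source]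
  exact (continuousOn_extChartAt_symm p).isOpen_inter_preimage (isOpen_extChartAt_target p)
    (isOpen_extChartAt_source p')

/-- The non-zero vectors in the domain of the chart at `p`, in coordinates. -/
def slitDomain (p : M) : Set (E × E) := {z | z.1 ∈ (extChartAt 𝓘(ℝ, E) p).target ∧ z.2 ≠ 0}

lemma isOpen_slitDomain (p : M) : IsOpen (slitDomain (E := E) p) :=
  ((isOpen_extChartAt_target p).preimage continuous_fst).inter
    (isOpen_ne.preimage continuous_snd)

variable [IsManifold 𝓘(ℝ, E) ∞ M]

lemma tangentChart_apply (p p' : M) (v : TangentSpace 𝓘(ℝ, E) p') :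
    extChartAt 𝓘(ℝ, E).tangent (⟨p, 0⟩ : TangentBundle 𝓘(ℝ, E) M) ⟨p', v⟩
      = (extChartAt 𝓘(ℝ, E) p p', tangentCoordChange 𝓘(ℝ, E) p' p p' v) := rfl

lemma mem_tangentChart_target (p : M) (z : E × E) :
    z ∈ (extChartAt 𝓘(ℝ, E).tangent (⟨p, 0⟩ : TangentBundle 𝓘(ℝ, E) M)).target
      ↔ z.1 ∈ (extChartAt 𝓘(ℝ, E) p).target := by
  rw [FiberBundle.extChartAt_target]
  constructor
  · exact fun h => h.1.1
  · refine fun h => ⟨⟨h, ?_⟩, trivial⟩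
    simpa using (extChartAt 𝓘(ℝ, E) p).map_target h

lemma tangentChart_symm_apply (p : M) (z : E × E) :
    (extChartAt 𝓘(ℝ, E).tangent (⟨p, 0⟩ : TangentBundle 𝓘(ℝ, E) M)).symm z
      = ⟨(extChartAt 𝓘(ℝ, E) p).symm z.1,
        tangentCoordChange 𝓘(ℝ, E) p ((extChartAt 𝓘(ℝ, E) p).symm z.1)
          ((extChartAt 𝓘(ℝ, E) p).symm z.1) z.2⟩ := rfl

lemma contDiffOn_transition (p p' : M) :
    ContDiffOn ℝ ∞ (transition (E := E) p p') (transitionDomain p p') :=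
  contDiffOn_ext_coord_change p' p

lemma fderiv_transition {p p' : M} {x : E} (hx : x ∈ transitionDomain p p') :
    fderiv ℝ (transition p p') x
      = tangentCoordChange 𝓘(ℝ, E) p p' ((extChartAt 𝓘(ℝ, E) p).symm x) := by
  rw [tangentCoordChange_def, (extChartAt 𝓘(ℝ, E) p).right_inv (mem_transitionDomain.1 hx).1,
    modelWithCornersSelf_coe, Set.range_id, fderivWithin_univ]
  rfl

lemma bijective_tangentCoordChange {p p' r : M} (hp : r ∈ (extChartAt 𝓘(ℝ, E) p).source)
    (hp' : r ∈ (extChartAt 𝓘(ℝ, E) p').source) :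
    Function.Bijective (tangentCoordChange 𝓘(ℝ, E) p p' r) := by
  rw [Function.bijective_iff_has_inverse]
  refine ⟨tangentCoordChange 𝓘(ℝ, E) p' p r, fun v => ?_, fun v => ?_⟩
  · rw [tangentCoordChange_comp ⟨⟨hp, hp'⟩, hp⟩, tangentCoordChange_self hp]
  · rw [tangentCoordChange_comp ⟨⟨hp', hp⟩, hp'⟩, tangentCoordChange_self hp']

lemma bijective_fderiv_transition {p p' : M} {x : E} (hx : x ∈ transitionDomain p p') :
    Function.Bijective (fderiv ℝ (transition p p') x) := by
  obtain ⟨h1, h2⟩ := mem_transitionDomain.1 hx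
  rw [fderiv_transition hx]
  exact bijective_tangentCoordChange ((extChartAt 𝓘(ℝ, E) p).map_target h1) h2

/-- The transition maps of the tangent bundle are the tangent maps of those of `M`. -/
lemma tangentChart_tangentChart_symm {p p' : M} {z : E × E} (hz : z.1 ∈ transitionDomain p p') :
    extChartAt 𝓘(ℝ, E).tangent (⟨p', 0⟩ : TangentBundle 𝓘(ℝ, E) M)
        ((extChartAt 𝓘(ℝ, E).tangent (⟨p, 0⟩ : TangentBundle 𝓘(ℝ, E) M)).symm z)
      = velocityLift (transition p p') z := by
  obtain ⟨h1, h2⟩ := mem_transitionDomain.1 hz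
  have h3 := (extChartAt 𝓘(ℝ, E) p).map_target h1
  rw [velocityLift, fderiv_transition hz]
  exact Prod.ext rfl (tangentCoordChange_comp ⟨⟨h3, mem_extChartAt_source _⟩, h2⟩)

lemma tangentChart_eq_velocityLift {p p' r : M} (hp : r ∈ (extChartAt 𝓘(ℝ, E) p).source)
    (hp' : r ∈ (extChartAt 𝓘(ℝ, E) p').source) (v : TangentSpace 𝓘(ℝ, E) r) :
    extChartAt 𝓘(ℝ, E).tangent (⟨p', 0⟩ : TangentBundle 𝓘(ℝ, E) M) ⟨r, v⟩
      = velocityLift (transition p p')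
        (extChartAt 𝓘(ℝ, E).tangent (⟨p, 0⟩ : TangentBundle 𝓘(ℝ, E) M) ⟨r, v⟩) := by
  have hmem : (⟨r, v⟩ : TangentBundle 𝓘(ℝ, E) M)
      ∈ (extChartAt 𝓘(ℝ, E).tangent (⟨p, 0⟩ : TangentBundle 𝓘(ℝ, E) M)).source := by
    rw [extChartAt_source, TangentBundle.mem_chart_source_iff]
    simpa using hp
  rw [← tangentChart_tangentChart_symm, PartialEquiv.left_inv _ hmem]
  rw [tangentChart_apply, mem_transitionDomain]
  exact ⟨PartialEquiv.map_source _ hp, by rwa [PartialEquiv.left_inv _ hp]⟩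

namespace FinslerSpacetime

variable (S : FinslerSpacetime E M)

lemma contDiffOn_inChart (p : M) : ContDiffOn ℝ ∞ (inChart S.L p) (slitDomain p) := by
  rw [← contMDiffOn_iff_contDiffOn]
  have h1 := contMDiffOn_extChartAt_symm (I := 𝓘(ℝ, E).tangent) (n := ∞)
    (⟨p, 0⟩ : TangentBundle 𝓘(ℝ, E) M)
  refine S.smooth.comp (h1.mono fun z hz => (mem_tangentChart_target p z).2 hz.1) fun z hz => ?_
  have h3 := (extChartAt 𝓘(ℝ, E) p).map_target hz.1
  have h4 := (bijective_tangentCoordChange h3 (mem_extChartAt_source _)).injective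
  exact fun h0 => hz.2 (h4 (h0.trans (map_zero _).symm))

lemma inChart_smul (p : M) {z : E × E} (hz : z ∈ slitDomain p) {s : ℝ} (hs : 0 < s) :
    inChart S.L p (z.1, s • z.2) = s ^ 2 * inChart S.L p z := by
  have h3 := (extChartAt 𝓘(ℝ, E) p).map_target hz.1
  have h4 := (bijective_tangentCoordChange h3 (mem_extChartAt_source _)).injective
  have h5 := S.homogeneous ((extChartAt 𝓘(ℝ, E) p).symm z.1)
    (tangentCoordChange 𝓘(ℝ, E) p ((extChartAt 𝓘(ℝ, E) p).symm z.1)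
      ((extChartAt 𝓘(ℝ, E) p).symm z.1) z.2)
    (fun h0 => hz.2 (h4 (h0.trans (map_zero _).symm))) s hs
  exact (congrArg (fun v : E => S.L ⟨(extChartAt 𝓘(ℝ, E) p).symm z.1, v⟩)
    (map_smul (tangentCoordChange 𝓘(ℝ, E) p ((extChartAt 𝓘(ℝ, E) p).symm z.1)
      ((extChartAt 𝓘(ℝ, E) p).symm z.1)) s z.2)).trans h5

/-- Both chart expressions read the same function `L`, and the transition maps of the tangent bundle
are the tangent maps of those of `M`; hence the laws for coordinate changes apply. -/
lemma isLagrangianMap_transition (p p' : M) :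
    IsLagrangianMap (transition p p') (transitionDomain p p') (inChart S.L p)
      {z | z.1 ∈ transitionDomain p p' ∧ z.2 ≠ 0} (inChart S.L p') (slitDomain p') where
  isOpen_base := isOpen_transitionDomain p p'
  contDiffOn := contDiffOn_transition p p'
  isOpen_source := ((isOpen_transitionDomain p p').preimage continuous_fst).inter
    (isOpen_ne.preimage continuous_snd)
  isOpen_target := isOpen_slitDomain p'
  contDiffOn_source := (S.contDiffOn_inChart p).mono
    fun _ hz => ⟨(mem_transitionDomain.1 hz.1).1, hz.2⟩
  contDiffOn_target := S.contDiffOn_inChart p'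
  fst_mem _ hz := hz.1
  mapsTo z hz := by
    refine ⟨PartialEquiv.map_source _ (mem_transitionDomain.1 hz.1).2, fun h0 => hz.2 ?_⟩
    exact (bijective_fderiv_transition hz.1).injective (h0.trans (map_zero _).symm)
  eq z hz := by
    rw [← tangentChart_tangentChart_symm hz.1, inChart, inChart, PartialEquiv.left_inv]
    rw [tangentChart_symm_apply, extChartAt_source, TangentBundle.mem_chart_source_iff]
    simpa using (mem_transitionDomain.1 hz.1).2

lemma isFinslerOn_inChart (p : M) : IsFinslerOn (inChart S.L p) (slitDomain p) where
  isOpen := isOpen_slitDomain p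
  contDiffOn := S.contDiffOn_inChart p
  conic z hz s hs := ⟨hz.1, smul_ne_zero hs.ne' hz.2⟩
  homogeneous z hz s hs := S.inChart_smul p hz hs
  nondegenerate z hz u hu := by
    -- The Lorentzian condition concerns the Hessian at a point only in the preferred chart of that
    -- point, so it is transported to the chart at `p`.
    set p' := (extChartAt 𝓘(ℝ, E) p).symm z.1 with hp'
    have hO : z.1 ∈ transitionDomain p p' :=
      mem_transitionDomain.2 ⟨hz.1, mem_extChartAt_source _⟩
    have hb := bijective_fderiv_transition hO
    have h := S.isLagrangianMap_transition p p'
    have hlor := S.lorentzian p' (fderiv ℝ (transition p p') z.1 z.2)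
      (fun h0 => hz.2 (hb.injective (h0.trans (map_zero _).symm)))
    refine hb.injective ((hlor.nondegenerate _ fun w' => ?_).trans (map_zero _).symm)
    obtain ⟨w, rfl⟩ := hb.surjective w'
    exact (h.localMetric_apply ⟨hO, hz.2⟩ u w).symm.trans (hu w)

end FinslerSpacetime

end Charts

/-! ### Fields along the hypersurface in charts. -/

section Hypersurface

variable {E : Type*} [NormedAddCommGroup E] [NormedSpace ℝ E]
  {M : Type*} [TopologicalSpace M] [ChartedSpace E M]
  {F : Type*} [NormedAddCommGroup F] [NormedSpace ℝ F]
  {H : Type*} [TopologicalSpace H] [ChartedSpace F H]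

/-- `mfderiv` is computed in the preferred chart at `ι q`, so composing with that chart leaves it
unchanged. -/
lemma mfderiv_extChartAt_comp_self {ι : H → M} {q : H}
    (hι : MDifferentiableAt 𝓘(ℝ, F) 𝓘(ℝ, E) ι q)
    (hx : MDifferentiableAt 𝓘(ℝ, F) 𝓘(ℝ, E) (fun q' => extChartAt 𝓘(ℝ, E) (ι q) (ι q')) q) :
    (mfderiv 𝓘(ℝ, F) 𝓘(ℝ, E) ι q : F →L[ℝ] E)
      = mfderiv 𝓘(ℝ, F) 𝓘(ℝ, E) (fun q' => extChartAt 𝓘(ℝ, E) (ι q) (ι q')) q :=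
  hι.mfderiv.trans hx.mfderiv.symm

lemma mfderiv_mfderiv_extChartAt_symm [IsManifold 𝓘(ℝ, F) 2 H] {f : H → E} {q : H} {y : F}
    (hy : y ∈ (extChartAt 𝓘(ℝ, F) q).target)
    (hf : MDifferentiableAt 𝓘(ℝ, F) 𝓘(ℝ, E) f ((extChartAt 𝓘(ℝ, F) q).symm y)) (ξ : F) :
    mfderiv 𝓘(ℝ, F) 𝓘(ℝ, E) f ((extChartAt 𝓘(ℝ, F) q).symm y)
        (mfderiv 𝓘(ℝ, F) 𝓘(ℝ, F) (extChartAt 𝓘(ℝ, F) q).symm y ξ)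
      = fderiv ℝ (f ∘ (extChartAt 𝓘(ℝ, F) q).symm) y ξ := by
  have h1 : MDifferentiableAt 𝓘(ℝ, F) 𝓘(ℝ, F) (extChartAt 𝓘(ℝ, F) q).symm y :=
    ((contMDiffOn_extChartAt_symm (n := 2) q).contMDiffAt
      ((isOpen_extChartAt_target q).mem_nhds hy)).mdifferentiableAt (by norm_num)
  rw [← mfderiv_eq_fderiv, mfderiv_comp y hf h1]
  rfl

variable [IsManifold 𝓘(ℝ, E) ∞ M]

/-- The coordinate expression of a field of vectors of `M` along `ι`, in the chart of `H` at `q`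
and the chart of the tangent bundle induced by the chart of `M` at `p`. -/
noncomputable def fieldInChart (ι : H → M) (σ : (q : H) → TangentSpace 𝓘(ℝ, E) (ι q)) (p : M)
    (q : H) (y : F) : E × E :=
  extChartAt 𝓘(ℝ, E).tangent (⟨p, 0⟩ : TangentBundle 𝓘(ℝ, E) M)
    ⟨ι ((extChartAt 𝓘(ℝ, F) q).symm y), σ ((extChartAt 𝓘(ℝ, F) q).symm y)⟩

variable {ι : H → M} {σ : (q : H) → TangentSpace 𝓘(ℝ, E) (ι q)}

lemma contMDiffAt_tangentChart
    (hσ : ContMDiff 𝓘(ℝ, F) 𝓘(ℝ, E).tangent 2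
      (fun q => (⟨ι q, σ q⟩ : TangentBundle 𝓘(ℝ, E) M))) {p : M} {q : H}
    (hq : ι q ∈ (extChartAt 𝓘(ℝ, E) p).source) :
    ContMDiffAt 𝓘(ℝ, F) 𝓘(ℝ, E × E) 2 (fun q' =>
      extChartAt 𝓘(ℝ, E).tangent (⟨p, 0⟩ : TangentBundle 𝓘(ℝ, E) M) ⟨ι q', σ q'⟩) q := by
  have h1 : ContMDiffAt 𝓘(ℝ, E).tangent 𝓘(ℝ, E × E) 2
      (extChartAt 𝓘(ℝ, E).tangent (⟨p, 0⟩ : TangentBundle 𝓘(ℝ, E) M)) ⟨ι q, σ q⟩ := by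
    refine contMDiffAt_extChartAt' ?_
    rw [TangentBundle.mem_chart_source_iff]
    simpa using hq
  exact ContMDiffAt.comp (f := fun q => (⟨ι q, σ q⟩ : TangentBundle 𝓘(ℝ, E) M)) q h1 (hσ q)

lemma contDiffAt_fieldInChart [IsManifold 𝓘(ℝ, F) 2 H]
    (hσ : ContMDiff 𝓘(ℝ, F) 𝓘(ℝ, E).tangent 2
      (fun q => (⟨ι q, σ q⟩ : TangentBundle 𝓘(ℝ, E) M))) {p : M} {q : H} {y : F}
    (hy : y ∈ (extChartAt 𝓘(ℝ, F) q).target)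
    (hq : ι ((extChartAt 𝓘(ℝ, F) q).symm y) ∈ (extChartAt 𝓘(ℝ, E) p).source) :
    ContDiffAt ℝ 2 (fieldInChart ι σ p q) y := by
  rw [← contMDiffAt_iff_contDiffAt]
  exact ContMDiffAt.comp (g := fun q' =>
      extChartAt 𝓘(ℝ, E).tangent (⟨p, 0⟩ : TangentBundle 𝓘(ℝ, E) M) ⟨ι q', σ q'⟩) y
    (contMDiffAt_tangentChart hσ hq)
    ((contMDiffOn_extChartAt_symm (n := 2) q).contMDiffAt
      ((isOpen_extChartAt_target q).mem_nhds hy))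

lemma fieldInChart_center (q : H) :
    fieldInChart ι σ (ι q) q (extChartAt 𝓘(ℝ, F) q q) = coords (ι q) (σ q) := by
  rw [fieldInChart, extChartAt_to_inv]
  exact Prod.ext rfl (tangentCoordChange_self (mem_extChartAt_source _))

lemma fieldInChart_self (q : H) (y : F) :
    fieldInChart ι σ (ι ((extChartAt 𝓘(ℝ, F) q).symm y)) q y
      = coords (ι ((extChartAt 𝓘(ℝ, F) q).symm y)) (σ ((extChartAt 𝓘(ℝ, F) q).symm y)) := by
  rw [fieldInChart, tangentChart_apply]
  exact Prod.ext rfl (tangentCoordChange_self (mem_extChartAt_source _))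

lemma fieldInChart_mem_slitDomain {p : M} {q : H} {y : F}
    (hq : ι ((extChartAt 𝓘(ℝ, F) q).symm y) ∈ (extChartAt 𝓘(ℝ, E) p).source)
    (h0 : σ ((extChartAt 𝓘(ℝ, F) q).symm y) ≠ 0) : fieldInChart ι σ p q y ∈ slitDomain p :=
  ⟨PartialEquiv.map_source _ hq, fun h => h0 ((bijective_tangentCoordChange
    (mem_extChartAt_source _) hq).injective (h.trans (map_zero _).symm))⟩

namespace FinslerSpacetime

variable (S : FinslerSpacetime E M)

/-- The covariant derivative along `H`, computed in an arbitrary chart of `M`. -/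
lemma covDeriv_eq_fieldInChart [FiniteDimensional ℝ E] [IsManifold 𝓘(ℝ, F) 2 H]
    (hι : ContMDiff 𝓘(ℝ, F) 𝓘(ℝ, E) 2 ι)
    (hσ : ContMDiff 𝓘(ℝ, F) 𝓘(ℝ, E).tangent 2
      (fun q => (⟨ι q, σ q⟩ : TangentBundle 𝓘(ℝ, E) M))) (hσ0 : ∀ q, σ q ≠ 0)
    {p : M} {q : H} {y : F} (hy : y ∈ (extChartAt 𝓘(ℝ, F) q).target)
    (hq : ι ((extChartAt 𝓘(ℝ, F) q).symm y) ∈ (extChartAt 𝓘(ℝ, E) p).source) (ξ : F) :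
    S.covDeriv ι σ ((extChartAt 𝓘(ℝ, F) q).symm y)
        (mfderiv 𝓘(ℝ, F) 𝓘(ℝ, F) (extChartAt 𝓘(ℝ, F) q).symm y ξ)
      = fderiv ℝ (transition p (ι ((extChartAt 𝓘(ℝ, F) q).symm y))) (fieldInChart ι σ p q y).1
        (fderiv ℝ (fun y => (fieldInChart ι σ p q y).2) y ξ
          + nonlinConn (inChart S.L p) (fieldInChart ι σ p q y)
            (fderiv ℝ (fun y => (fieldInChart ι σ p q y).1) y ξ)) := by
  set q' := (extChartAt 𝓘(ℝ, F) q).symm y with hq'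
  -- `covDeriv` at `q'` is defined in the chart at the moving point `ι q'`; `φ` compares it with the
  -- fixed chart at `p`.
  set φ : E → E := transition p (ι q') with hφ
  have hself : ι q' ∈ (extChartAt 𝓘(ℝ, E) (ι q')).source := mem_extChartAt_source _
  have hc := (contMDiffAt_tangentChart hσ hself).mdifferentiableAt (by norm_num)
  have hc1 : MDifferentiableAt 𝓘(ℝ, F) 𝓘(ℝ, E)
      (fun r => extChartAt 𝓘(ℝ, E) (ι q') (ι r)) q' :=
    MDifferentiableAt.comp (g := Prod.fst) q'
      (ContinuousLinearMap.fst ℝ E E).differentiableAt.mdifferentiableAt hc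
  have hc2 : MDifferentiableAt 𝓘(ℝ, F) 𝓘(ℝ, E) (fun r =>
      (extChartAt 𝓘(ℝ, E).tangent (⟨ι q', 0⟩ : TangentBundle 𝓘(ℝ, E) M) ⟨ι r, σ r⟩).2) q' :=
    MDifferentiableAt.comp (g := Prod.snd) q'
      (ContinuousLinearMap.snd ℝ E E).differentiableAt.mdifferentiableAt hc
  have hpush := mfderiv_extChartAt_comp_self ((hι q').mdifferentiableAt (by norm_num)) hc1
  have e1 := mfderiv_mfderiv_extChartAt_symm hy hc1 ξ
  have e2 := mfderiv_mfderiv_extChartAt_symm hy hc2 ξ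
  have hz := fieldInChart_mem_slitDomain (σ := σ) hq (hσ0 _)
  have hd := (contDiffAt_fieldInChart hσ hy hq).differentiableAt (by norm_num)
  have hmap := S.isLagrangianMap_transition p (ι q')
  have hO : (fieldInChart ι σ p q y).1 ∈ transitionDomain p (ι q') :=
    mem_transitionDomain.2 ⟨hz.1, by
      have h1 : (extChartAt 𝓘(ℝ, E) p).symm (fieldInChart ι σ p q y).1 = ι q' :=
        PartialEquiv.left_inv _ hq
      rw [h1]; exact hself⟩
  have hF : IsFinslerOn (inChart S.L p) {z | z.1 ∈ transitionDomain p (ι q') ∧ z.2 ≠ 0} := by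
    have h := S.isFinslerOn_inChart p
    have hsub : ∀ z ∈ {z : E × E | z.1 ∈ transitionDomain p (ι q') ∧ z.2 ≠ 0},
        z ∈ slitDomain p := fun z hz => ⟨(mem_transitionDomain.1 hz.1).1, hz.2⟩
    exact ⟨hmap.isOpen_source, hmap.contDiffOn_source,
      fun z hz s hs => ⟨hz.1, smul_ne_zero hs.ne' hz.2⟩,
      fun z hz => h.homogeneous z (hsub z hz), fun z hz => h.nondegenerate z (hsub z hz)⟩
  have key := hmap.covDeriv_velocityLift hF (S.isFinslerOn_inChart (ι q'))
    (fun z hz => (bijective_fderiv_transition hz.1).surjective)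
    (x := fun y => (fieldInChart ι σ p q y).1) (s := fun y => (fieldInChart ι σ p q y).2)
    hd.fst hd.snd ⟨hO, hz.2⟩ ξ
  -- Equality is needed on a neighbourhood because both sides are differentiated at `y`.
  have hev : ∀ᶠ y' in nhds y, fieldInChart ι σ (ι q') q y'
      = velocityLift φ (fieldInChart ι σ p q y') := by
    have hcont : ContinuousAt (fun y' => ι ((extChartAt 𝓘(ℝ, F) q).symm y')) y :=
      ContinuousAt.comp (g := ι) hι.continuous.continuousAt (continuousAt_extChartAt_symm'' hy)
    filter_upwards [hcont.preimage_mem_nhds (extChartAt_source_mem_nhds' hq),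
      hcont.preimage_mem_nhds (extChartAt_source_mem_nhds' hself)] with y' h1 h2
    exact tangentChart_eq_velocityLift h1 h2 _
  have f1 : fderiv ℝ (φ ∘ fun y => (fieldInChart ι σ p q y).1) y
      = fderiv ℝ ((fun r => extChartAt 𝓘(ℝ, E) (ι q') (ι r)) ∘ (extChartAt 𝓘(ℝ, F) q).symm) y :=
    Filter.EventuallyEq.fderiv_eq (hev.mono fun y' h => (congrArg Prod.fst h).symm)
  have f2 : fderiv ℝ (fun y => fderiv ℝ φ (fieldInChart ι σ p q y).1 (fieldInChart ι σ p q y).2) y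
      = fderiv ℝ ((fun r => (extChartAt 𝓘(ℝ, E).tangent (⟨ι q', 0⟩ : TangentBundle 𝓘(ℝ, E) M)
        ⟨ι r, σ r⟩).2) ∘ (extChartAt 𝓘(ℝ, F) q).symm) y :=
    Filter.EventuallyEq.fderiv_eq (hev.mono fun y' h => (congrArg Prod.snd h).symm)
  have f3 : velocityLift φ (fieldInChart ι σ p q y) = coords (ι q') (σ q') :=
    hev.self_of_nhds.symm.trans (fieldInChart_self q y)
  refine Eq.trans ?_ key
  rw [f1, f2, ← e1, ← e2]
  have f4 : velocityLift φ ((fieldInChart ι σ p q y).1, (fieldInChart ι σ p q y).2)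
    = coords (ι q') (σ q') := f3
  rw [f4]
  exact congrArg₂ (· + ·) rfl (congrArg
    (nonlinConn (inChart S.L (ι q')) (coords (ι q') (σ q'))) (congrFun (congrArg DFunLike.coe hpush) _))

lemma fderiv_transition_fieldInChart {p : M} {q : H} {y : F}
    (hq : ι ((extChartAt 𝓘(ℝ, F) q).symm y) ∈ (extChartAt 𝓘(ℝ, E) p).source) :
    fderiv ℝ (transition p (ι ((extChartAt 𝓘(ℝ, F) q).symm y))) (fieldInChart ι σ p q y).1
      (fieldInChart ι σ p q y).2 = σ ((extChartAt 𝓘(ℝ, F) q).symm y) := by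
  have h1 := tangentChart_eq_velocityLift hq (mem_extChartAt_source _)
    (σ ((extChartAt 𝓘(ℝ, F) q).symm y))
  exact (congrArg Prod.snd h1).symm.trans (congrArg Prod.snd (fieldInChart_self q y))

end FinslerSpacetime

end Hypersurface

/-! ### Curvature and Ricci form along the null hypersurface. -/

namespace FinslerSpacetime

variable {E : Type*} [NormedAddCommGroup E] [NormedSpace ℝ E]
  {M : Type*} [TopologicalSpace M] [ChartedSpace E M] [IsManifold 𝓘(ℝ, E) ∞ M]
  (S : FinslerSpacetime E M)
  {F : Type*} [NormedAddCommGroup F] [NormedSpace ℝ F]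
  {H : Type*} [TopologicalSpace H] [ChartedSpace F H]
  {ι : H → M} {σ : (q : H) → TangentSpace 𝓘(ℝ, E) (ι q)}
  {om : (q : H) → (TangentSpace 𝓘(ℝ, F) q →L[ℝ] ℝ)}

lemma push_eq_fderiv_fieldInChart (hι : ContMDiff 𝓘(ℝ, F) 𝓘(ℝ, E) 2 ι) (q : H) :
    (push ι q : F →L[ℝ] E)
      = fderiv ℝ (fun y => (fieldInChart ι σ (ι q) q y).1) (extChartAt 𝓘(ℝ, F) q q) := by
  have h := ((hι q).mdifferentiableAt (by norm_num)).mfderiv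
  rw [modelWithCornersSelf_coe, Set.range_id, fderivWithin_univ] at h
  exact h

/-- The equation `D_X σ = om(X) σ` in the charts at `q` and `ι q`. -/
lemma eventually_covDeriv_fieldInChart [FiniteDimensional ℝ E] [IsManifold 𝓘(ℝ, F) 2 H]
    (hι : ContMDiff 𝓘(ℝ, F) 𝓘(ℝ, E) 2 ι)
    (hσ : ContMDiff 𝓘(ℝ, F) 𝓘(ℝ, E).tangent 2
      (fun q => (⟨ι q, σ q⟩ : TangentBundle 𝓘(ℝ, E) M))) (hσ0 : ∀ q, σ q ≠ 0)
    (hom : ∀ (q : H) (X : TangentSpace 𝓘(ℝ, F) q), S.covDeriv ι σ q X = om q X • σ q) (q : H) :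
    ∀ᶠ y in nhds (extChartAt 𝓘(ℝ, F) q q), ∀ ξ,
      fderiv ℝ (fun y => (fieldInChart ι σ (ι q) q y).2) y ξ
          + nonlinConn (inChart S.L (ι q)) (fieldInChart ι σ (ι q) q y)
            (fderiv ℝ (fun y => (fieldInChart ι σ (ι q) q y).1) y ξ)
        = formInChart om q y ξ • (fieldInChart ι σ (ι q) q y).2 := by
  have hcont : ContinuousAt (fun y' => ι ((extChartAt 𝓘(ℝ, F) q).symm y'))
      (extChartAt 𝓘(ℝ, F) q q) :=
    ContinuousAt.comp (g := ι) hι.continuous.continuousAt (continuousAt_extChartAt_symm q)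
  have hmem : (extChartAt 𝓘(ℝ, E) (ι q)).source
      ∈ nhds (ι ((extChartAt 𝓘(ℝ, F) q).symm (extChartAt 𝓘(ℝ, F) q q))) := by
    rw [extChartAt_to_inv]
    exact extChartAt_source_mem_nhds _
  filter_upwards [extChartAt_target_mem_nhds q, hcont.preimage_mem_nhds hmem] with y hy hq ξ
  have hz := fieldInChart_mem_slitDomain (σ := σ) hq (hσ0 _)
  have hO : (fieldInChart ι σ (ι q) q y).1
      ∈ transitionDomain (ι q) (ι ((extChartAt 𝓘(ℝ, F) q).symm y)) :=
    mem_transitionDomain.2 ⟨hz.1, by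
      have h1 : (extChartAt 𝓘(ℝ, E) (ι q)).symm (fieldInChart ι σ (ι q) q y).1
          = ι ((extChartAt 𝓘(ℝ, F) q).symm y) := PartialEquiv.left_inv _ hq
      rw [h1]; exact mem_extChartAt_source _⟩
  -- The differential of the transition map carries both sides to the chart at the moving point,
  -- where the equation is the hypothesis `hom`.
  apply (bijective_fderiv_transition hO).injective
  have h1 := S.covDeriv_eq_fieldInChart hι hσ hσ0 hy hq ξ
  have h2 := hom _ (mfderiv 𝓘(ℝ, F) 𝓘(ℝ, F) (extChartAt 𝓘(ℝ, F) q).symm y ξ)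
  refine h1.symm.trans (h2.trans ?_)
  rw [map_smul]
  exact congrArg (formInChart om q y ξ • ·) (fderiv_transition_fieldInChart hq).symm

/-- A 1-form `om` with `D_X σ = om(X) σ` is of class `C¹`, and its exterior derivative is the
curvature. -/
lemma isC1Form_and_curvature_eq [FiniteDimensional ℝ E] [IsManifold 𝓘(ℝ, F) 2 H]
    (hι : ContMDiff 𝓘(ℝ, F) 𝓘(ℝ, E) 2 ι)
    (hσ : ContMDiff 𝓘(ℝ, F) 𝓘(ℝ, E).tangent 2
      (fun q => (⟨ι q, σ q⟩ : TangentBundle 𝓘(ℝ, E) M))) (hσ0 : ∀ q, σ q ≠ 0)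
    (hom : ∀ (q : H) (X : TangentSpace 𝓘(ℝ, F) q), S.covDeriv ι σ q X = om q X • σ q) :
    IsC1Form om ∧ ∀ (q : H) (X Y : TangentSpace 𝓘(ℝ, F) q),
      S.curvature (ι q) (σ q) (push ι q X) (push ι q Y) = dForm om q X Y • σ q := by
  have hsmooth (q : H) : ContDiffAt ℝ 2 (fieldInChart ι σ (ι q) q) (extChartAt 𝓘(ℝ, F) q q) :=
    contDiffAt_fieldInChart hσ (mem_extChartAt_target q)
      (by rw [extChartAt_to_inv]; exact mem_extChartAt_source _)
  have hmem (q : H) :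
      fieldInChart ι σ (ι q) q (extChartAt 𝓘(ℝ, F) q q) ∈ slitDomain (ι q) := by
    rw [fieldInChart_center]
    exact ⟨mem_extChartAt_target _, hσ0 q⟩
  have hev := S.eventually_covDeriv_fieldInChart hι hσ hσ0 hom
  have hC1 : IsC1Form om := fun q =>
    contDiffAt_of_smulRight_eq
      ((S.isFinslerOn_inChart (ι q)).contDiffAt_covDeriv (hsmooth q).fst (hsmooth q).snd (hmem q))
      ((hsmooth q).snd.of_le (by norm_num)) (hmem q).2 (hev q)
  refine ⟨hC1, fun q X Y => ?_⟩
  have h1 := (S.isFinslerOn_inChart (ι q)).localCurvature_eq (hsmooth q).fst (hsmooth q).snd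
    (hmem q) ((hC1 q).differentiableAt (by norm_num)) (hev q) X Y
  rw [Prod.mk.eta, fieldInChart_center, ← push_eq_fderiv_fieldInChart hι q] at h1
  exact h1

/-- The trace lemma applies with `ℓ = g_k(k, ·)`: it is non-zero by nondegeneracy, its kernel is the
tangent space of `H`, and it annihilates the curvature. -/
lemma ricciForm_eq_of_curvature_eq [FiniteDimensional ℝ E] {q : H}
    (hinj : Function.Injective (push (E := E) (F := F) ι q)) {k : TangentSpace 𝓘(ℝ, F) q}
    (hk : S.IsNullGenerator ι q k)
    (hR : ∀ X Y : TangentSpace 𝓘(ℝ, F) q,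
      S.curvature (ι q) (push ι q k) (push ι q X) (push ι q Y) = dForm om q X Y • push ι q k)
    (Y : TangentSpace 𝓘(ℝ, F) q) :
    S.ricciForm (ι q) (push ι q k) (push ι q Y) = dForm om q k Y := by
  have hΛ := S.isFinslerOn_inChart (ι q)
  have hz : coords (E := E) (ι q) (push ι q k) ∈ slitDomain (E := E) (ι q) :=
    ⟨mem_extChartAt_target _, hk.1.1⟩
  let ℓ : E →L[ℝ] ℝ := S.metric (ι q) (push ι q k) (push ι q k)
  have hℓ (w : E) : ℓ w = fderiv ℝ (inChart S.L (ι q)) (coords (ι q) (push ι q k)) (0, w) :=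
    hΛ.localMetric_velocity hz w
  -- `B.flip Y - B Y` is `X ↦ dForm om q X Y` as a linear functional.
  let B : F →L[ℝ] F →L[ℝ] ℝ := fderiv ℝ (formInChart om q) (extChartAt 𝓘(ℝ, F) q q)
  let j : F →L[ℝ] E := push ι q
  refine trace_eq_of_map_hyperplane (E := E) (F := F)
    ((localCurvature (inChart S.L (ι q)) (coords (ι q) (push ι q k))).flip
      (push ι q Y) : E →L[ℝ] E)
    (j : F →ₗ[ℝ] E) hinj (ℓ : E →ₗ[ℝ] ℝ) ?_ hk.2 (fun u => ?_) k
    (B.flip Y - B Y : F →L[ℝ] ℝ) (fun X => hR X Y)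
  · intro h0
    exact hk.1.1 (hΛ.nondegenerate _ hz _ fun w => LinearMap.congr_fun h0 w)
  · exact (hℓ _).trans (hΛ.fderiv_curvature hz _ _)

end FinslerSpacetime

end LorentzFinsler

open scoped Manifold ContDiff in
open LorentzFinsler LorentzFinsler.FinslerSpacetime in
theorem mainTheorem3
    {E : Type*} [NormedAddCommGroup E] [NormedSpace ℝ E] [FiniteDimensional ℝ E]
    {M : Type*} [TopologicalSpace M] [ChartedSpace E M] [IsManifold 𝓘(ℝ, E) ∞ M]
    (S : FinslerSpacetime E M)
    {F : Type*} [NormedAddCommGroup F] [NormedSpace ℝ F] [FiniteDimensional ℝ F]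
    {H : Type*} [TopologicalSpace H] [ChartedSpace F H] [IsManifold 𝓘(ℝ, F) 2 H]
    (ι : H → M) (hH : S.IsNullHypersurface (F := F) ι)
    (n : (q : H) → TangentSpace 𝓘(ℝ, F) q)
    (hn : ∀ q, S.IsNullGenerator ι q (n q))
    (hn_smooth : ContMDiff 𝓘(ℝ, F) 𝓘(ℝ, E).tangent 2
      (fun q => (⟨ι q, push ι q (n q)⟩ : TangentBundle 𝓘(ℝ, E) M)))
    (om : (q : H) → (TangentSpace 𝓘(ℝ, F) q →L[ℝ] ℝ))
    (h_om : S.IsTotallyGeodesicWith ι n om) :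
    IsC1Form om ∧
    (∀ (q : H) (X Y : TangentSpace 𝓘(ℝ, F) q),
      S.curvature (ι q) (push ι q (n q)) (push ι q X) (push ι q Y)
        = dForm om q X Y • push ι q (n q)) ∧
    (∀ (q : H) (Y : TangentSpace 𝓘(ℝ, F) q),
      S.ricciForm (ι q) (push ι q (n q)) (push ι q Y) = dForm om q (n q) Y) := by
  obtain ⟨hC1, hR⟩ := S.isC1Form_and_curvature_eq hH.contMDiff hn_smooth
    (fun q => (hn q).1.1) h_om
  exact ⟨hC1, hR, fun q Y =>
    S.ricciForm_eq_of_curvature_eq (hH.immersion q) (hn q) (hR q) Y⟩
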